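/- Let $c\in\mathbb R$, let $\mathbb R^n(c)$ be the simply connected $n$-dimensional space form of curvature $c$ (round sphere, Euclidean space or hyperbolic space), and let $B^n\subset\mathbb R^n(c)$ be a closed geodesic ball of radius $r>0$, with $r<\pi/\sqrt c$ if $c>0$, with outward unit normal $\boldsymbol n$ along $\partial B^n$. Let $(\Sigma,g)$ be a Riemannian surface with non-empty smooth boundary, and let $u:\Sigma\to B^n$ be a branched immersion with $u(\partial\Sigma)\subset\partial B^n$, that is, $u$ is smooth, weakly conformal ($u^*\langle\cdot,\cdot\rangle=\rho g$ with $\rho\ge 0$) and immersed outside a finite set $\mathcal B$. For a hypersurface $K$ and $p\in\partial\Sigma\setminus\mathcal B$, let $\boldsymbol\tau$ be a unit tangent vector of the boundary curve $u|_{\partial\Sigma}$ and $\boldsymbol\nu$ the outward unit conormal of the surface at $p$. The contact angle of $u$ with $K$ at $p$ is the $\theta(p)\in[0,\pi/2]$ with $\cos\theta(p)=\max\{\langle x,\boldsymbol\nu\rangle : x\in T_{u(p)}K,\ |x|=1,\ x\perp\boldsymbol\tau\}$ (the maximum over the empty set being $0$). Assume: (i) the mean curvature vector $\bar H$ of $u$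 in $\mathbb R^n(c)$ is parallel in the normal bundle on $\Sigma\setminus\mathcal B$, $\nabla^\perp\bar H\equiv 0$, and $\bar H\not\equiv 0$; (ii) $u$ has constant contact angle $\theta\in(0,\pi/2]$ with $\partial B^n$ along $\partial\Sigma\setminus\mathcal B$; (iii) $u(\Sigma)$ is contained in a connected embedded totally umbilical hypersurface $M^{n-1}\subset\mathbb R^n(c)$ with smooth unit normal field $\boldsymbol\xi$. Then: (a) the mean curvature vector $H$ of $u$ as a surface in $M$ is parallel in the normal bundle of the surface in $M$, $\nabla^{\perp,M}H\equiv 0$ on $\Sigma\setminus\mathcal B$; (b) $C:=M\cap\partial B^n$ is a smooth totally umbilical hypersurface of $M$, and there are constants $\alpha\in(0,\pi)$ and $\theta_M\in(0,\pi/2]$ such that along all of $\partial\Sigma$ one has $\langle\boldsymbol n,\boldsymbol\xi\rangle=\cos\alpha$, in particular $|\langle\boldsymbol n,\boldsymbol\xi\rangle|<1$ (so $M$ and $\partial B^n$ are transverse there), $u$ has contact angle $\theta_M$ with $C$ inside $M$ at every point of $\partial\Sigma\setminus\mathcal B$, and $$\sin\theta_M=\frac{\sin\theta}{\sqrt{1-\langle\boldsymbol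 n,\boldsymbol\xi\rangle^2}}=\frac{\sin\theta}{\sin\alpha}.$$ -/

import Mathlib

open scoped Manifold ContDiff

namespace SpaceFormPMC

/-! ### The space form of curvature `c`

The model is `{(t, y) ∈ ℝ × ℝⁿ : t² + c |y|² = 1}` (with `t > 0` if `c ≤ 0`), with the metric induced
by `|dy|² + dt² / c`: the round sphere of radius `1/√c` if `c > 0` (with `t/√c` as the last Euclidean
coordinate), one sheet of the hyperboloid in Minkowski space if `c < 0`, and the affine hyperplane
`t = 1`, a copy of Euclidean `ℝⁿ`, if `c = 0`. -/

/-- The linear space `ℝ × ℝⁿ` that contains the model. -/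
abbrev Amb (n : ℕ) : Type := ℝ × EuclideanSpace ℝ (Fin n)

/-- The metric `⟨v, w⟩ = v_y · w_y + v_t w_t / c`. For `c = 0` the last term is zero; tangent vectors of
the model have `v_t = 0` in that case, so nothing is lost. -/
noncomputable def met {n : ℕ} (c : ℝ) (v w : Amb n) : ℝ :=
  inner ℝ v.2 w.2 + c⁻¹ * (v.1 * w.1)

/-- The form `t t' + c y · y'`, which is `c ⟨·, ·⟩` for `c ≠ 0`. The model is a part of its unit
sphere. -/
noncomputable def quad {n : ℕ} (c : ℝ) (x v : Amb n) : ℝ :=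
  x.1 * v.1 + c * inner ℝ x.2 v.2

/-- The space form `ℝⁿ(c)`: sphere, Euclidean space or hyperbolic space of curvature `c`. -/
def spaceForm (n : ℕ) (c : ℝ) : Set (Amb n) :=
  {x | quad c x x = 1 ∧ (c ≤ 0 → 0 < x.1)}

/-- The projection of `ℝ × ℝⁿ` onto the tangent space `{v | quad c x v = 0}` of the space form at `x`,
along the position vector `x`, which is orthogonal to that tangent space if `c ≠ 0` (for `c = 0` the
derivative of a tangent field is tangent already). Hence `projN c x (D_X Y)` is the Levi-Civita
connection of the space form. -/
noncomputable def projN {n : ℕ} (c : ℝ) (x z : Amb n) : Amb n :=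
  z - quad c x z • x

/-! ### Geodesic balls -/

/-- The solution of `s'' + c s = 0`, `s 0 = 0`, `s' 0 = 1`. -/
noncomputable def sn (c t : ℝ) : ℝ :=
  if 0 < c then Real.sin (√c * t) / √c
  else if c < 0 then Real.sinh (√(-c) * t) / √(-c)
  else t

/-- The solution of `s'' + c s = 0`, `s 0 = 1`, `s' 0 = 0`. -/
noncomputable def cs (c t : ℝ) : ℝ :=
  if 0 < c then Real.cos (√c * t)
  else if c < 0 then Real.cosh (√(-c) * t)
  else 1

/-- The geodesic of the space form with initial point `o` and unit initial velocity `v`. -/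
noncomputable def geod {n : ℕ} (c : ℝ) (o v : Amb n) (t : ℝ) : Amb n :=
  cs c t • o + sn c t • v

/-- Unit tangent vectors of the space form at `o`. -/
def unitTangent {n : ℕ} (c : ℝ) (o : Amb n) : Set (Amb n) :=
  {v | quad c o v = 0 ∧ met c v v = 1}

/-- The closed geodesic ball with centre `o` and radius `r`. -/
def geodBall {n : ℕ} (c : ℝ) (o : Amb n) (r : ℝ) : Set (Amb n) :=
  {x | ∃ v ∈ unitTangent c o, ∃ t ∈ Set.Icc 0 r, x = geod c o v t}

/-- The boundary of the geodesic ball, a geodesic sphere. -/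
def geodSphere {n : ℕ} (c : ℝ) (o : Amb n) (r : ℝ) : Set (Amb n) :=
  {x | ∃ v ∈ unitTangent c o, x = geod c o v r}

/-- The outward unit normal of the geodesic ball at a boundary point `x`, that is, the velocity at time
`r` of the unit speed geodesic from `o` that reaches `x` at time `r`. -/
noncomputable def outNormal {n : ℕ} (c : ℝ) (o : Amb n) (r : ℝ) (x : Amb n) : Amb n :=
  (sn c r)⁻¹ • (cs c r • x - o)

/-! ### Submanifolds and totally umbilical hypersurfaces -/

/-- `X` is a smooth embedded submanifold of codimension `k` of the linear space `ℝ × ℝⁿ`. -/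
def IsSubmanifold {n : ℕ} (k : ℕ) (X : Set (Amb n)) : Prop :=
  ∀ p ∈ X, ∃ U : Set (Amb n), IsOpen U ∧ p ∈ U ∧ ∃ F : Amb n → (Fin k → ℝ),
    ContDiffOn ℝ ∞ F U ∧ Function.Surjective (fderiv ℝ F p) ∧ X ∩ U = {x ∈ U | F x = 0}

/-- The tangent space of the submanifold `X` at `p`: the vectors that annihilate every smooth function
that vanishes on `X` near `p`. -/
def tangentTo {n : ℕ} (X : Set (Amb n)) (p : Amb n) : Submodule ℝ (Amb n) where
  carrier := {v | ∀ f : Amb n → ℝ, ContDiffAt ℝ ∞ f p → (∀ᶠ x in nhdsWithin p X, f x = 0) →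
    fderiv ℝ f p v = 0}
  zero_mem' := fun f _ _ => map_zero _
  add_mem' := fun {v w} hv hw f hf h0 => by rw [map_add, hv f hf h0, hw f hf h0, add_zero]
  smul_mem' := fun a v hv f hf h0 => by rw [map_smul, hv f hf h0, smul_zero]

/-- `X` is a totally umbilical hypersurface, with unit normal field `η`, of the submanifold `W` of the
space form. Here `P x` is the orthogonal projection onto the tangent space of `W` at `x ∈ W`, so that
`P x (D_v Y)` is the Levi-Civita connection of `W`, and `k` is the codimension of `X` in `ℝ × ℝⁿ`. The
field `η` only matters on `X`; off `X` it is any local smooth extension. -/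
structure IsUmbilicalHypersurface {n : ℕ} (c : ℝ) (W : Set (Amb n)) (P : Amb n → Amb n → Amb n)
    (k : ℕ) (X : Set (Amb n)) (η : Amb n → Amb n) : Prop where
  subset : X ⊆ W
  submanifold : IsSubmanifold k X
  smooth : ∀ p ∈ X, ContDiffAt ℝ ∞ η p
  tangent : ∀ p ∈ X, η p ∈ tangentTo W p
  unit : ∀ p ∈ X, met c (η p) (η p) = 1
  normal : ∀ p ∈ X, ∀ v ∈ tangentTo X p, met c (η p) v = 0
  umbilic : ∀ p ∈ X, ∃ l : ℝ, ∀ v ∈ tangentTo X p, P p (fderiv ℝ η p v) = -(l • v)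

/-- The orthogonal projection onto the tangent space, at `x`, of a hypersurface of the space form with
unit normal field `ξ`. -/
noncomputable def projM {n : ℕ} (c : ℝ) (ξ : Amb n → Amb n) (x z : Amb n) : Amb n :=
  projN c x z - met c (projN c x z) (ξ x) • ξ x

/-! ### Branched immersed surfaces

Surfaces with boundary are modelled on the half plane `{y | 0 ≤ y 0}`. The tangent space at `p` is `ℝ²`
in the coordinates of the preferred chart at `p`; at a boundary point, `w 0 = 0` says that `w` is
tangent to the boundary and `w 0 < 0` that it points outward. -/

section Surface

variable {n : ℕ} {S : Type*} [TopologicalSpace S] [ChartedSpace (EuclideanHalfSpace 2) S]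

/-- The differential of `u` at `p`. -/
noncomputable def du (u : S → Amb n) (p : S) : EuclideanSpace ℝ (Fin 2) →L[ℝ] Amb n :=
  mfderiv (𝓡∂ 2) 𝓘(ℝ, Amb n) u p

/-- The points at which `u` is not immersed. -/
def branchSet (u : S → Amb n) : Set S :=
  {p | ¬ Function.Injective (du u p)}

/-- `u` is a branched immersion: smooth, weakly conformal for the metric `g`, and immersed except at
finitely many points. -/
structure IsBranchedImmersion [IsManifold (𝓡∂ 2) ∞ S] (c : ℝ)
    (g : Bundle.ContMDiffRiemannianMetric (𝓡∂ 2) ∞ (EuclideanSpace ℝ (Fin 2))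
      (fun p : S => TangentSpace (𝓡∂ 2) p))
    (u : S → Amb n) : Prop where
  smooth : ContMDiff (𝓡∂ 2) 𝓘(ℝ, Amb n) ∞ u
  mem : ∀ p, u p ∈ spaceForm n c
  conformal : ∃ ρ : S → ℝ, ∀ p, 0 ≤ ρ p ∧
    ∀ v w : TangentSpace (𝓡∂ 2) p, met c (du u p v) (du u p w) = ρ p * g.inner p v w
  finite : (branchSet u).Finite

/-- The component of `z` orthogonal to the plane spanned by `a` and `b`. -/
noncomputable def perp (c : ℝ) (a b z : Amb n) : Amb n :=
  z - (met c a a * met c b b - met c a b ^ 2)⁻¹ •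
    ((met c b b * met c z a - met c a b * met c z b) • a +
      (met c a a * met c z b - met c a b * met c z a) • b)

/-- The partial derivative `∂ᵢ f` of a map on the closed half plane (one-sided at the boundary). -/
noncomputable def pd {F : Type*} [NormedAddCommGroup F] [NormedSpace ℝ F]
    (i : Fin 2) (f : EuclideanSpace ℝ (Fin 2) → F) (y : EuclideanSpace ℝ (Fin 2)) : F :=
  fderivWithin ℝ f (Set.range (𝓡∂ 2)) y (EuclideanSpace.single i 1)

/-- The component of `z` normal to the parametrized surface `f` at `y`, inside the tangent space of a
submanifold of the space form that contains the surface and has tangential projection `P`. -/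
noncomputable def normalPart (c : ℝ) (P : Amb n → Amb n → Amb n)
    (f : EuclideanSpace ℝ (Fin 2) → Amb n) (y : EuclideanSpace ℝ (Fin 2)) (z : Amb n) : Amb n :=
  perp c (pd 0 f y) (pd 1 f y) (P (f y) z)

/-- The second fundamental form `A(∂ᵢ f, ∂ⱼ f)` of the parametrized surface `f` in that submanifold,
the normal part of the covariant derivative of `∂ⱼ f` along `∂ᵢ f`. -/
noncomputable def secondFF (c : ℝ) (P : Amb n → Amb n → Amb n)
    (f : EuclideanSpace ℝ (Fin 2) → Amb n) (i j : Fin 2) (y : EuclideanSpace ℝ (Fin 2)) : Amb n :=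
  normalPart c P f y (pd i (pd j f) y)

/-- The mean curvature vector, half the trace of the second fundamental form with respect to the first
fundamental form. -/
noncomputable def meanCurv (c : ℝ) (P : Amb n → Amb n → Amb n)
    (f : EuclideanSpace ℝ (Fin 2) → Amb n) (y : EuclideanSpace ℝ (Fin 2)) : Amb n :=
  (2 * (met c (pd 0 f y) (pd 0 f y) * met c (pd 1 f y) (pd 1 f y)
      - met c (pd 0 f y) (pd 1 f y) ^ 2))⁻¹ •
    (met c (pd 1 f y) (pd 1 f y) • secondFF c P f 0 0 y
      - (2 * met c (pd 0 f y) (pd 1 f y)) • secondFF c P f 0 1 y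
      + met c (pd 0 f y) (pd 0 f y) • secondFF c P f 1 1 y)

/-- The map `u` in the coordinates of the preferred chart at `p`. -/
noncomputable def localRep (u : S → Amb n) (p : S) : EuclideanSpace ℝ (Fin 2) → Amb n :=
  u ∘ (extChartAt (𝓡∂ 2) p).symm

/-- The mean curvature vector of `u` at `p`, in the submanifold with tangential projection `P`. -/
noncomputable def meanCurvAt (c : ℝ) (P : Amb n → Amb n → Amb n) (u : S → Amb n) (p : S) : Amb n :=
  meanCurv c P (localRep u p) (extChartAt (𝓡∂ 2) p p)

/-- The mean curvature vector `H` of `u`, in the submanifold with tangential projection `P`, is parallel: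
away from the branch points the normal part of the covariant derivative of `H` in each direction
vanishes. -/
def HasParallelMeanCurv (c : ℝ) (P : Amb n → Amb n → Amb n) (u : S → Amb n) : Prop :=
  ∀ p ∉ branchSet u, ∀ i : Fin 2,
    normalPart c P (localRep u p) (extChartAt (𝓡∂ 2) p p)
      (pd i (meanCurv c P (localRep u p)) (extChartAt (𝓡∂ 2) p p)) = 0

/-- `ν` is the outward unit conormal of the surface at the boundary point `p`. -/
def IsOutConormal (c : ℝ) (u : S → Amb n) (p : S) (ν : Amb n) : Prop :=
  met c ν ν = 1 ∧ (∃ w : EuclideanSpace ℝ (Fin 2), w 0 < 0 ∧ ν = du u p w) ∧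
    ∀ t : EuclideanSpace ℝ (Fin 2), t 0 = 0 → met c (du u p t) ν = 0

/-- `θ ∈ [0, π/2]` is the contact angle of the surface with `K` at the boundary point `p`: `cos θ` is
the maximum of `⟨x, ν⟩` over the unit vectors `x` tangent to `K` and orthogonal to the boundary curve.
That maximum is non-negative, since `-x` competes with `x`, so adding `0` has no effect unless there is
no such `x`; this happens only if `K` is a curve, and then `ν` is normal to `K` and the angle is
`π/2`. -/
def IsContactAngle (c : ℝ) (K : Set (Amb n)) (u : S → Amb n) (p : S) (θ : ℝ) : Prop :=
  θ ∈ Set.Icc 0 (Real.pi / 2) ∧ ∃ ν, IsOutConormal c u p ν ∧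
    IsGreatest (insert 0 {s | ∃ x ∈ tangentTo K (u p), met c x x = 1 ∧
      (∀ t : EuclideanSpace ℝ (Fin 2), t 0 = 0 → met c x (du u p t) = 0) ∧ s = met c x ν})
      (Real.cos θ)

end Surface

end SpaceFormPMC

open SpaceFormPMC

/-! Everything follows from the Weingarten equation `D_v ξ = -l v` on `M` with constant `l`. The
derivative of `ξ` has no component along the position vector, so the equation holds for plain
derivatives in the ambient linear space. Constancy of `l` is the Codazzi argument
(`exists_const_curvature`). It needs `dim M ≥ 2`, which holds because `M` contains an immersed
surface.

Parallel mean curvature: the two second fundamental forms differ by `l g ⊗ ξ`, so the mean curvature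
vectors differ by `l ξ` (`meanCurv_projN_eq`). The derivative of `l ξ` along the surface is tangent
to the surface and does not affect the normal connection.

Constant angle between `M` and the sphere: by Weingarten, `⟨x - o, ξ⟩ + (l/2) |x - o|²` is constant
on `M`. The chord length `|x - o|` is constant on the geodesic sphere, and `⟨x - o, ξ⟩` is `sn c r`
times `⟨n, ξ⟩`, so `⟨n, ξ⟩` is a constant `κ` on the intersection. The normalized vector `n - κ ξ`
is then the unit normal of the intersection in `M`, and it inherits umbilicity from `n` and `ξ`.

Contact angles: for a hypersurface with unit normal `m` the maximum is the length of the part of `ν`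
orthogonal to `m`, so `sin θ = |⟨m, ν⟩|` (`isGreatest_contact`). Since `ν ⊥ ξ`, passing from `m = n`
to the normalized `n - κ ξ` divides the sine by `√(1 - κ²)`. Cauchy-Schwarz gives `sin² θ ≤ 1 - κ²`,
and `θ > 0` then forces `|κ| < 1`. -/

namespace SpaceFormPMC

/-! ### The two bilinear forms; positivity on tangent spaces -/

section Metric

variable {n : ℕ} (c : ℝ)

/-- The metric as a continuous bilinear form. -/
noncomputable def metL : Amb n →L[ℝ] Amb n →L[ℝ] ℝ :=
  (innerSL ℝ).bilinearComp (ContinuousLinearMap.snd ℝ _ _) (ContinuousLinearMap.snd ℝ _ _) +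
    c⁻¹ • (ContinuousLinearMap.mul ℝ ℝ).bilinearComp (ContinuousLinearMap.fst ℝ _ _)
      (ContinuousLinearMap.fst ℝ _ _)

/-- The form `quad c` as a continuous bilinear form. -/
noncomputable def quadL : Amb n →L[ℝ] Amb n →L[ℝ] ℝ :=
  (ContinuousLinearMap.mul ℝ ℝ).bilinearComp (ContinuousLinearMap.fst ℝ _ _)
      (ContinuousLinearMap.fst ℝ _ _) +
    c • (innerSL ℝ).bilinearComp (ContinuousLinearMap.snd ℝ _ _) (ContinuousLinearMap.snd ℝ _ _)

variable {c}

theorem metL_apply (v w : Amb n) : metL c v w = met c v w := by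
  simp [metL, met]

theorem quadL_apply (v w : Amb n) : quadL c v w = quad c v w := by
  simp [quadL, quad]

theorem met_comm (v w : Amb n) : met c v w = met c w v := by
  simp [met, real_inner_comm, mul_comm]

theorem quad_comm (v w : Amb n) : quad c v w = quad c w v := by
  simp [quad, real_inner_comm, mul_comm]

theorem met_add_left (u v w : Amb n) : met c (u + v) w = met c u w + met c v w := by
  simp [← metL_apply]

theorem met_add_right (u v w : Amb n) : met c u (v + w) = met c u v + met c u w := by
  simp [← metL_apply]

theorem met_sub_left (u v w : Amb n) : met c (u - v) w = met c u w - met c v w := by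
  simp [← metL_apply]

theorem met_sub_right (u v w : Amb n) : met c u (v - w) = met c u v - met c u w := by
  simp [← metL_apply]

theorem met_smul_left (a : ℝ) (v w : Amb n) : met c (a • v) w = a * met c v w := by
  simp [← metL_apply]

theorem met_smul_right (a : ℝ) (v w : Amb n) : met c v (a • w) = a * met c v w := by
  simp [← metL_apply]

theorem met_neg_right (v w : Amb n) : met c v (-w) = -met c v w := by
  simp [← metL_apply]

theorem met_zero_left (w : Amb n) : met c 0 w = 0 := by
  simp [← metL_apply]

theorem quad_add_left (u v w : Amb n) : quad c (u + v) w = quad c u w + quad c v w := by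
  simp [← quadL_apply]

theorem quad_add_right (u v w : Amb n) : quad c u (v + w) = quad c u v + quad c u w := by
  simp [← quadL_apply]

theorem quad_sub_right (u v w : Amb n) : quad c u (v - w) = quad c u v - quad c u w := by
  simp [← quadL_apply]

theorem quad_smul_left (a : ℝ) (v w : Amb n) : quad c (a • v) w = a * quad c v w := by
  simp [← quadL_apply]

theorem quad_smul_right (a : ℝ) (v w : Amb n) : quad c v (a • w) = a * quad c v w := by
  simp [← quadL_apply]

theorem quad_zero_right (v : Amb n) : quad c v 0 = 0 := by
  simp [← quadL_apply]

theorem quad_eq_mul_met (hc : c ≠ 0) (v w : Amb n) : quad c v w = c * met c v w := by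
  simp only [quad, met]
  field_simp
  ring

/-- Tangent vectors of the space form satisfy `quad c v w = c * met c v w` also for `c = 0`. -/
theorem quad_eq_mul_met_of_tangent {x v : Amb n} (hx : x ∈ spaceForm n c) (hv : quad c x v = 0)
    (w : Amb n) : quad c v w = c * met c v w := by
  by_cases hc : c = 0
  · subst hc
    have h0 : 0 < x.1 := hx.2 le_rfl
    have : v.1 = 0 := by simpa [quad, h0.ne'] using hv
    simp [quad, this]
  · exact quad_eq_mul_met hc v w

/-- The form is indefinite on the ambient space for `c < 0` and degenerate for `c = 0`. For `c < 0`,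
tangency and Cauchy-Schwarz bound `x.1² v.1²` by `c² |x.2|² |v.2|²`, and with `x.1² = 1 - c |x.2|²`
this gives `x.1² ⟨v, v⟩ ≥ |v.2|²`. For `c = 0`, tangency forces `v.1 = 0`. -/
theorem met_self_pos {x v : Amb n} (hx : x ∈ spaceForm n c) (hv : quad c x v = 0)
    (hv0 : v ≠ 0) : 0 < met c v v := by
  obtain ⟨hxx, hpos⟩ := hx
  have hn : met c v v = ‖v.2‖ ^ 2 + c⁻¹ * v.1 ^ 2 := by
    simp [met, sq]
  have hq : x.1 ^ 2 + c * ‖x.2‖ ^ 2 = 1 := by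
    rw [← hxx]; simp [quad, sq]
  have hcs : inner ℝ x.2 v.2 ^ 2 ≤ ‖x.2‖ ^ 2 * ‖v.2‖ ^ 2 := by
    have := abs_real_inner_le_norm x.2 v.2
    rw [← mul_pow, ← sq_abs]
    gcongr
  have hq' : x.1 * v.1 = -(c * inner ℝ x.2 v.2) := by
    have : x.1 * v.1 + c * inner ℝ x.2 v.2 = 0 := hv
    linarith
  have key : c ≤ 0 → v.2 = 0 → v.1 = 0 := by
    intro h h2
    have := hpos h
    simpa [h2, this.ne'] using hq'
  rw [hn]
  rcases lt_trichotomy c 0 with hc | hc | hc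
  · have h2 : v.2 ≠ 0 := fun h => hv0 (Prod.ext (key hc.le h) h)
    have hp := hpos hc.le
    have h2' : 0 < ‖v.2‖ ^ 2 := by positivity
    have h3 : x.1 ^ 2 * v.1 ^ 2 ≤ c ^ 2 * (‖x.2‖ ^ 2 * ‖v.2‖ ^ 2) := by
      rw [← mul_pow, hq', neg_sq, mul_pow]
      gcongr
    have h4 : x.1 ^ 2 * (‖v.2‖ ^ 2 + c⁻¹ * v.1 ^ 2) ≥ ‖v.2‖ ^ 2 := by
      have h5 : c⁻¹ * (c ^ 2 * (‖x.2‖ ^ 2 * ‖v.2‖ ^ 2)) ≤ c⁻¹ * (x.1 ^ 2 * v.1 ^ 2) :=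
        mul_le_mul_of_nonpos_left h3 (inv_nonpos.2 hc.le)
      have h6 : c⁻¹ * (c ^ 2 * (‖x.2‖ ^ 2 * ‖v.2‖ ^ 2)) = c * ‖x.2‖ ^ 2 * ‖v.2‖ ^ 2 := by
        field_simp [hc.ne]
      have h7 : x.1 ^ 2 * ‖v.2‖ ^ 2 = (1 - c * ‖x.2‖ ^ 2) * ‖v.2‖ ^ 2 := by rw [← hq]; ring
      nlinarith
    have h5 : 0 < x.1 ^ 2 * (‖v.2‖ ^ 2 + c⁻¹ * v.1 ^ 2) := by linarith
    exact pos_of_mul_pos_right h5 (sq_nonneg _)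
  · have h2 : v.2 ≠ 0 := fun h => hv0 (Prod.ext (key hc.le h) h)
    subst hc
    simp only [inv_zero, zero_mul, add_zero]
    positivity
  · have : 0 < c⁻¹ := inv_pos.2 hc
    by_cases h2 : v.2 = 0
    · have h1 : v.1 ≠ 0 := fun h => hv0 (Prod.ext h h2)
      positivity
    · positivity

theorem met_self_nonneg {x v : Amb n} (hx : x ∈ spaceForm n c) (hv : quad c x v = 0) :
    0 ≤ met c v v := by
  by_cases h : v = 0
  · simp [h, met]
  · exact (met_self_pos hx hv h).le

/-- The Cauchy-Schwarz inequality in tangent spaces of the space form, for a unit vector. -/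
theorem met_sq_le {x v w : Amb n} (hx : x ∈ spaceForm n c) (hv : quad c x v = 0)
    (hw : quad c x w = 0) (hv1 : met c v v = 1) : met c v w ^ 2 ≤ met c w w := by
  have h : 0 ≤ met c (w - met c v w • v) (w - met c v w • v) :=
    met_self_nonneg hx (by rw [quad_sub_right, quad_smul_right, hv, hw]; ring)
  simp only [met_sub_left, met_sub_right, met_smul_left, met_smul_right, hv1, met_comm w v] at h
  nlinarith

/-- The vector `⟨a, a⟩ b - ⟨a, b⟩ a` is non-zero and its squared length is `⟨a, a⟩` times the Gram
determinant. -/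
theorem gram_pos {x a b : Amb n} (hx : x ∈ spaceForm n c) (ha : quad c x a = 0)
    (hb : quad c x b = 0) (hab : ∀ s t : ℝ, s • a + t • b = 0 → s = 0 ∧ t = 0) :
    0 < met c a a * met c b b - met c a b ^ 2 := by
  have ha0 : a ≠ 0 := by
    rintro rfl
    simpa using hab 1 0 (by simp)
  have hpa := met_self_pos hx ha ha0
  have hw : met c a a • b + (-met c a b) • a ≠ 0 := by
    intro h
    have := hab (-met c a b) (met c a a) (by rw [add_comm]; exact h)
    exact hpa.ne' this.2
  have h := met_self_pos hx
    (by rw [quad_add_right, quad_smul_right, quad_smul_right, ha, hb]; ring) hw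
  simp only [met_add_left, met_add_right, met_smul_left, met_smul_right, met_comm b a] at h
  have : 0 < met c a a * (met c a a * met c b b - met c a b ^ 2) := by nlinarith
  exact pos_of_mul_pos_right this hpa.le

end Metric

/-! ### Generalized trigonometric functions -/

section Trig

variable {c : ℝ}

theorem cs_sq_add_mul_sn_sq (r : ℝ) : cs c r ^ 2 + c * sn c r ^ 2 = 1 := by
  unfold cs sn
  split_ifs with h1 h2
  · rw [div_pow, Real.sq_sqrt h1.le]
    field_simp
    exact Real.cos_sq_add_sin_sq _
  · rw [div_pow, Real.sq_sqrt (by linarith)]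
    rw [Real.cosh_sq]
    have := h2.ne
    field_simp
    ring
  · have : c = 0 := by linarith
    simp [this]

theorem sn_pos {r : ℝ} (hr : 0 < r) (hrc : 0 < c → r < Real.pi / √c) : 0 < sn c r := by
  unfold sn
  split_ifs with h1 h2
  · have hs : 0 < √c := Real.sqrt_pos.2 h1
    refine div_pos (Real.sin_pos_of_pos_of_lt_pi (by positivity) ?_) hs
    have := hrc h1
    rw [lt_div_iff₀ hs] at this
    linarith
  · have hs : 0 < √(-c) := Real.sqrt_pos.2 (by linarith)
    exact div_pos (Real.sinh_pos_iff.2 (by positivity)) hs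
  · exact hr

theorem cs_zero_curv (r : ℝ) : cs 0 r = 1 := by simp [cs]

end Trig

/-! ### Tangent spaces and local parametrizations of level sets -/

section Submanifold

open Filter Topology

variable {n k : ℕ} {X : Set (Amb n)} {p : Amb n}

/-- The tangent space of a level set is contained in the kernel of the differential. -/
theorem fderiv_eq_zero_of_mem_tangentTo {F : Amb n → Fin k → ℝ} (hF : ContDiffAt ℝ ∞ F p)
    (h0 : ∀ᶠ x in 𝓝[X] p, F x = 0) {v : Amb n} (hv : v ∈ tangentTo X p) :
    fderiv ℝ F p v = 0 := by
  ext i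
  have hd : HasFDerivAt F (fderiv ℝ F p) p := (hF.differentiableAt (by simp)).hasFDerivAt
  have hi := hasFDerivAt_pi'.1 hd i
  have := hv (fun x => F x i) (contDiffAt_pi.1 hF i) (h0.mono fun x hx => by simp [hx])
  rw [hi.fderiv] at this
  simpa using this

/-- The local parametrization of a level set by the kernel of the differential. -/
theorem exists_parametrization_ker {F : Amb n → Fin k → ℝ} {U : Set (Amb n)} (hU : IsOpen U)
    (hpU : p ∈ U) (hpX : p ∈ X) (hF : ContDiffOn ℝ ∞ F U)
    (hsurj : Function.Surjective (fderiv ℝ F p)) (hX : X ∩ U = {x ∈ U | F x = 0}) :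
    ∃ (φ : (fderiv ℝ F p).ker → Amb n) (π : Amb n →L[ℝ] (fderiv ℝ F p).ker),
      ContDiffAt ℝ 2 φ 0 ∧ φ 0 = p ∧ HasFDerivAt φ (fderiv ℝ F p).ker.subtypeL 0 ∧
      map φ (𝓝 0) = 𝓝[X] p ∧ ∀ᶠ y in 𝓝 0, π (φ y - p) = y := by
  have hFp : ContDiffAt ℝ ∞ F p := hF.contDiffAt (hU.mem_nhds hpU)
  have hs : HasStrictFDerivAt F (fderiv ℝ F p) p := hFp.hasStrictFDerivAt (by simp)
  have hr : (fderiv ℝ F p).range = ⊤ := LinearMap.range_eq_top.2 hsurj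
  have hker : (fderiv ℝ F p).ker.ClosedComplemented :=
    Submodule.ClosedComplemented.of_finiteDimensional _
  -- With `π` a projection onto the kernel, `x ↦ (F x, π (x - p))` is a local diffeomorphism sending
  -- `p` to `(0, 0)`. The map `φ` is its inverse on the slice `{0} × ker`.
  set D := hs.implicitFunctionDataOfComplemented F _ hr hker with hD
  have hF0 : F p = 0 := by
    have : p ∈ X ∩ U := ⟨hpX, hpU⟩
    rw [hX] at this
    exact this.2
  have hright : D.rightFun p = 0 := by simp [hD]
  have hpt : D.pt = p := rfl
  have hleft : D.leftFun = F := rfl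
  have hpair : D.prodFun D.pt = (0, 0) := by
    rw [ImplicitFunctionData.prodFun_apply, hpt, hright, hleft, hF0]
  refine ⟨D.implicitFunction 0, Classical.choose hker, ?_, ?_, ?_, ?_, ?_⟩
  · have h := D.contDiffAt_implicitFunction (n := 2) (by exact_mod_cast contDiffAt_infty.1 hFp 2)
      (by simp only [hD, HasStrictFDerivAt.implicitFunctionDataOfComplemented]; fun_prop) (by simp)
    rw [hpair] at h
    exact h.comp (0 : (fderiv ℝ F p).ker) (f := fun y => ((0 : Fin k → ℝ), y)) (by fun_prop)
  · have h := D.implicitFunction_apply_image.self_of_nhds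
    rwa [hpt, hright, hleft, hF0] at h
  · have h := D.hasStrictFDerivAt_implicitFunction (fderiv ℝ F p).ker.subtypeL
      (by ext1 y; exact Classical.choose_spec hker y)
      (by ext1 y; exact y.2)
    rw [hpt, hright, hleft, hF0] at h
    exact h.hasFDerivAt
  · have h := D.map_implicitFunction_nhdsWithin_preimage Set.univ
    rw [hpt, hright, hleft, hF0, Set.preimage_univ, nhdsWithin_univ, Set.univ_inter] at h
    rw [h, ← nhdsWithin_inter_of_mem' (mem_nhdsWithin_of_mem_nhds (hU.mem_nhds hpU)),
      ← nhdsWithin_inter_of_mem' (s := X) (mem_nhdsWithin_of_mem_nhds (hU.mem_nhds hpU)), hX]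
    congr 1
    ext x
    simp [and_comm]
  · have h := D.rightFun_implicitFunction
    rw [hpair, nhds_prod_eq] at h
    have h2 := h.curry.self_of_nhds
    exact h2

/-- The tangent space of a regular level set is the kernel of the differential. -/
theorem mem_tangentTo_iff {F : Amb n → Fin k → ℝ} {U : Set (Amb n)} (hU : IsOpen U)
    (hpU : p ∈ U) (hpX : p ∈ X) (hF : ContDiffOn ℝ ∞ F U)
    (hsurj : Function.Surjective (fderiv ℝ F p)) (hX : X ∩ U = {x ∈ U | F x = 0}) {v : Amb n} :
    v ∈ tangentTo X p ↔ fderiv ℝ F p v = 0 := by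
  constructor
  · refine fderiv_eq_zero_of_mem_tangentTo (hF.contDiffAt (hU.mem_nhds hpU)) ?_
    filter_upwards [mem_nhdsWithin_of_mem_nhds (hU.mem_nhds hpU), self_mem_nhdsWithin] with x h1 h2
    have : x ∈ X ∩ U := ⟨h2, h1⟩
    rw [hX] at this
    exact this.2
  · intro hv f hf h0
    obtain ⟨φ, π, -, h1, h2, h3, -⟩ := exists_parametrization_ker hU hpU hpX hF hsurj hX
    rw [← h3, eventually_map] at h0
    have hfd : HasFDerivAt f (fderiv ℝ f p) (φ 0) := by
      rw [h1]; exact (hf.differentiableAt (by simp)).hasFDerivAt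
    have h4 := hfd.comp 0 h2
    have h5 : HasFDerivAt (f ∘ φ) (0 : (fderiv ℝ F p).ker →L[ℝ] ℝ) 0 :=
      (hasFDerivAt_const (0 : ℝ) _).congr_of_eventuallyEq h0
    simpa using DFunLike.congr_fun (h4.unique h5) ⟨v, hv⟩

/-- A submanifold is locally parametrized by its tangent space. -/
theorem IsSubmanifold.exists_parametrization (hX : IsSubmanifold k X) (hp : p ∈ X) :
    ∃ (φ : tangentTo X p → Amb n) (π : Amb n →L[ℝ] tangentTo X p),
      ContDiffAt ℝ 2 φ 0 ∧ φ 0 = p ∧ map φ (𝓝 0) = 𝓝[X] p ∧ ∀ᶠ y in 𝓝 0, π (φ y - p) = y := by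
  obtain ⟨U, hU, hpU, F, hF, hsurj, hXU⟩ := hX p hp
  have h : tangentTo X p = (fderiv ℝ F p).ker := by
    ext v
    exact mem_tangentTo_iff hU hpU hp hF hsurj hXU
  obtain ⟨φ, π, h0, h1, -, h3, h4⟩ := exists_parametrization_ker hU hpU hp hF hsurj hXU
  rw [h]
  exact ⟨φ, π, h0, h1, h3, h4⟩

theorem finrank_amb : Module.finrank ℝ (Amb n) = n + 1 := by
  simp [Amb, add_comm]

theorem IsSubmanifold.finrank_tangentTo (hX : IsSubmanifold k X) (hp : p ∈ X) :
    Module.finrank ℝ (tangentTo X p) + k = n + 1 := by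
  obtain ⟨U, hU, hpU, F, hF, hsurj, hXU⟩ := hX p hp
  have h : tangentTo X p = (fderiv ℝ F p).ker := by
    ext v
    exact mem_tangentTo_iff hU hpU hp hF hsurj hXU
  have h1 := (fderiv ℝ F p : Amb n →ₗ[ℝ] Fin k → ℝ).finrank_range_add_finrank_ker
  rw [LinearMap.range_eq_top.2 hsurj, finrank_top, finrank_amb] at h1
  rw [h]
  simpa [add_comm] using h1

end Submanifold

/-! ### Local constancy -/

section Conformal

open Filter Topology

/-- If the differential of a `C²` map `Ψ` is a multiple `μ` of the identity in dimension at least two,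
then `μ` is locally constant. -/
theorem eventually_eq_of_fderiv_eq_smul_id {V : Type*} [NormedAddCommGroup V] [NormedSpace ℝ V]
    [FiniteDimensional ℝ V] (hV : 2 ≤ Module.finrank ℝ V) {Ψ : V → V} {μ : V → ℝ} {y₀ : V}
    (hΨ : ContDiffAt ℝ 2 Ψ y₀) (h : ∀ᶠ y in 𝓝 y₀, ∀ w, fderiv ℝ Ψ y w = μ y • w) :
    ∀ᶠ y in 𝓝 y₀, μ y = μ y₀ := by
  have hnt : Nontrivial V := Module.nontrivial_of_finrank_pos (R := ℝ) (by omega)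
  obtain ⟨w₀, hw₀⟩ := exists_ne (0 : V)
  obtain ⟨ℓ, -, hℓ⟩ := exists_dual_vector ℝ w₀ (norm_ne_zero_iff.2 hw₀)
  have hnw : ‖w₀‖ ≠ 0 := norm_ne_zero_iff.2 hw₀
  have hμ : ∀ᶠ y in 𝓝 y₀, DifferentiableAt ℝ μ y ∧ fderiv ℝ μ y = 0 := by
    filter_upwards [(hΨ.eventually (by simp)), h.eventually_nhds] with y hy hy'
    have hd : DifferentiableAt ℝ (fderiv ℝ Ψ) y :=
      (hy.fderiv_right (m := 1) (by norm_num)).differentiableAt (by simp)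
    have hμd : DifferentiableAt ℝ μ y := by
      have h1 : DifferentiableAt ℝ (fun z => ‖w₀‖⁻¹ * ℓ (fderiv ℝ Ψ z w₀)) y := by fun_prop
      refine h1.congr_of_eventuallyEq ?_
      filter_upwards [hy'] with z hz
      rw [hz, map_smul, hℓ]
      simp
      field_simp
    refine ⟨hμd, ?_⟩
    -- Symmetry of the second derivative turns this into `dμ(v) w = dμ(w) v`. If `dμ(v) ≠ 0`, every
    -- `w` is a multiple of `v`, contradicting dimension at least two.
    have hsecond : ∀ v w, fderiv ℝ (fderiv ℝ Ψ) y v w = fderiv ℝ μ y v • w := by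
      intro v w
      have e : (fun z => fderiv ℝ Ψ z w) =ᶠ[𝓝 y] fun z => μ z • w := by
        filter_upwards [hy'] with z hz using hz w
      have h1 : HasFDerivAt (fun z => fderiv ℝ Ψ z w)
          ((ContinuousLinearMap.apply ℝ V w).comp (fderiv ℝ (fderiv ℝ Ψ) y)) y :=
        (ContinuousLinearMap.apply ℝ V w).hasFDerivAt.comp y hd.hasFDerivAt
      have h2 := (hμd.hasFDerivAt.smul_const w).congr_of_eventuallyEq e
      simpa using DFunLike.congr_fun (h1.unique h2) v
    have hsymm : IsSymmSndFDerivAt ℝ Ψ y := hy.isSymmSndFDerivAt (by simp)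
    ext v
    by_contra hv
    have hv0 : v ≠ 0 := by rintro rfl; simp at hv
    have hspan : ∀ w : V, ∃ a : ℝ, a • v = w := by
      intro w
      have h1 := hsymm.eq v w
      rw [hsecond, hsecond] at h1
      refine ⟨(fderiv ℝ μ y v)⁻¹ * fderiv ℝ μ y w, ?_⟩
      rw [mul_smul, ← h1, smul_smul, inv_mul_cancel₀ (by simpa using hv), one_smul]
    have := finrank_le_one v hspan
    omega
  obtain ⟨ε, hε, hb⟩ := Metric.eventually_nhds_iff_ball.1 hμ
  filter_upwards [Metric.ball_mem_nhds y₀ hε] with y hy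
  exact (convex_ball y₀ ε).is_const_of_fderivWithin_eq_zero (𝕜 := ℝ)
    (fun z hz => (hb z hz).1.differentiableWithinAt)
    (fun z hz => by
      rw [fderivWithin_of_isOpen Metric.isOpen_ball hz, (hb z hz).2]) hy (Metric.mem_ball_self hε)

/-- A map with vanishing differential near a point is locally constant. -/
theorem eventually_eq_of_hasFDerivAt_zero {V G : Type*} [NormedAddCommGroup V] [NormedSpace ℝ V]
    [NormedAddCommGroup G] [NormedSpace ℝ G] {f : V → G} {y₀ : V}
    (h : ∀ᶠ y in 𝓝 y₀, HasFDerivAt f (0 : V →L[ℝ] G) y) : ∀ᶠ y in 𝓝 y₀, f y = f y₀ := by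
  obtain ⟨ε, hε, hb⟩ := Metric.eventually_nhds_iff_ball.1 h
  filter_upwards [Metric.ball_mem_nhds y₀ hε] with y hy
  exact (convex_ball y₀ ε).is_const_of_fderivWithin_eq_zero (𝕜 := ℝ)
    (fun z hz => (hb z hz).differentiableAt.differentiableWithinAt)
    (fun z hz => by
      rw [fderivWithin_of_isOpen Metric.isOpen_ball hz, (hb z hz).fderiv])
      hy (Metric.mem_ball_self hε)

/-- A function that is locally constant on a preconnected set is constant there. -/
theorem eq_of_eventually_nhdsWithin_eq {Y Z : Type*} [TopologicalSpace Y] {s : Set Y}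
    (hs : IsPreconnected s) {f : Y → Z} (h : ∀ x ∈ s, ∀ᶠ y in 𝓝[s] x, f y = f x) {x y : Y}
    (hx : x ∈ s) (hy : y ∈ s) : f x = f y := by
  have : PreconnectedSpace s := isPreconnected_iff_preconnectedSpace.1 hs
  have hl : IsLocallyConstant (fun z : s => f z) := by
    rw [IsLocallyConstant.iff_eventually_eq]
    intro z
    have := h z z.2
    rw [nhdsWithin_eq_map_subtype_coe z.2, eventually_map] at this
    exact this
  exact hl.apply_eq_of_preconnectedSpace ⟨x, hx⟩ ⟨y, hy⟩

end Conformal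

/-! ### Product rules and tangency of derivatives -/

section Derivatives

open Filter Topology

variable {n : ℕ} {c : ℝ} {E : Type*} [NormedAddCommGroup E] [NormedSpace ℝ E]

theorem HasFDerivWithinAt.met {f g : E → Amb n} {f' g' : E →L[ℝ] Amb n} {s : Set E} {y : E}
    (hf : HasFDerivWithinAt f f' s y) (hg : HasFDerivWithinAt g g' s y) :
    HasFDerivWithinAt (fun z => met c (f z) (g z))
      ((metL c (f y)).comp g' + ((metL c).flip (g y)).comp f') s y := by
  have h := (metL (n := n) c).hasFDerivWithinAt_of_bilinear hf hg
  simp only [metL_apply] at h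
  refine h.congr_fderiv ?_
  ext1 w
  simp

theorem HasFDerivAt.met {f g : E → Amb n} {f' g' : E →L[ℝ] Amb n} {y : E}
    (hf : HasFDerivAt f f' y) (hg : HasFDerivAt g g' y) :
    HasFDerivAt (fun z => met c (f z) (g z))
      ((metL c (f y)).comp g' + ((metL c).flip (g y)).comp f') y := by
  rw [← hasFDerivWithinAt_univ] at *
  exact HasFDerivWithinAt.met hf hg

theorem HasFDerivAt.quad {f g : E → Amb n} {f' g' : E →L[ℝ] Amb n} {y : E}
    (hf : HasFDerivAt f f' y) (hg : HasFDerivAt g g' y) :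
    HasFDerivAt (fun z => quad c (f z) (g z))
      ((quadL c (f y)).comp g' + ((quadL c).flip (g y)).comp f') y := by
  have h := (quadL (n := n) c).hasFDerivAt_of_bilinear hf hg
  simp only [quadL_apply] at h
  refine h.congr_fderiv ?_
  ext1 w
  simp

theorem ContDiffAt.met {f g : E → Amb n} {m : WithTop ℕ∞} {y : E}
    (hf : ContDiffAt ℝ m f y) (hg : ContDiffAt ℝ m g y) :
    ContDiffAt ℝ m (fun z => met c (f z) (g z)) y := by
  simp only [← metL_apply]
  fun_prop

theorem ContDiffAt.quad {f g : E → Amb n} {m : WithTop ℕ∞} {y : E}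
    (hf : ContDiffAt ℝ m f y) (hg : ContDiffAt ℝ m g y) :
    ContDiffAt ℝ m (fun z => quad c (f z) (g z)) y := by
  simp only [← quadL_apply]
  fun_prop

theorem ContinuousWithinAt.met {Y : Type*} [TopologicalSpace Y] {f g : Y → Amb n} {s : Set Y} {y : Y}
    (hf : ContinuousWithinAt f s y) (hg : ContinuousWithinAt g s y) :
    ContinuousWithinAt (fun z => met c (f z) (g z)) s y := by
  simp only [← metL_apply]
  fun_prop

/-- Derivatives of maps into `X` are tangent to `X`. -/
theorem mem_tangentTo_of_hasFDerivWithinAt {X : Set (Amb n)} {f : E → Amb n} {f' : E →L[ℝ] Amb n}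
    {s : Set E} {y : E} (hf : HasFDerivWithinAt f f' s y) (hs : UniqueDiffWithinAt ℝ s y)
    (hy : y ∈ s) (hX : ∀ᶠ z in 𝓝[s] y, f z ∈ X) (w : E) : f' w ∈ tangentTo X (f y) := by
  intro h hh h0
  have h1 : Tendsto f (𝓝[s] y) (𝓝[X] (f y)) :=
    tendsto_nhdsWithin_iff.2 ⟨hf.continuousWithinAt, hX⟩
  have h2 := (hh.differentiableAt (by simp)).hasFDerivAt.comp_hasFDerivWithinAt y hf
  have h3 : HasFDerivWithinAt (h ∘ f) (0 : E →L[ℝ] ℝ) s y :=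
    (hasFDerivWithinAt_const (0 : ℝ) _ _).congr_of_eventuallyEq (h1.eventually h0)
      (h0.self_of_nhdsWithin (hX.self_of_nhdsWithin hy))
  simpa using DFunLike.congr_fun (hs.eq h2 h3) w

theorem mem_tangentTo_of_hasFDerivAt {X : Set (Amb n)} {f : E → Amb n} {f' : E →L[ℝ] Amb n}
    {y : E} (hf : HasFDerivAt f f' y) (hX : ∀ᶠ z in 𝓝 y, f z ∈ X) (w : E) :
    f' w ∈ tangentTo X (f y) :=
  mem_tangentTo_of_hasFDerivWithinAt hf.hasFDerivWithinAt uniqueDiffWithinAt_univ (Set.mem_univ _)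
    (by rwa [nhdsWithin_univ]) w

theorem quad_eq_zero_of_mem_tangentTo {X : Set (Amb n)} (hX : X ⊆ spaceForm n c) {p v : Amb n}
    (hv : v ∈ tangentTo X p) : quad c p v = 0 := by
  have h := hv (fun x => quad c x x - 1)
    ((ContDiffAt.quad contDiffAt_id contDiffAt_id).sub contDiffAt_const)
    (eventually_nhdsWithin_of_forall fun x hx => sub_eq_zero.2 (hX hx).1)
  rw [((HasFDerivAt.quad (c := c) (f := fun x => x) (g := fun x => x)
    (hasFDerivAt_id p) (hasFDerivAt_id p)).sub_const 1).fderiv] at h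
  simp [quadL_apply, quad_comm v p] at h
  exact h

theorem projN_of_tangent {x v : Amb n} (hv : quad c x v = 0) : projN c x v = v := by
  simp [projN, hv]

theorem projN_add (x z w : Amb n) : projN c x (z + w) = projN c x z + projN c x w := by
  simp only [projN, quad_add_right]
  module

theorem projN_smul (a : ℝ) (x z : Amb n) : projN c x (a • z) = a • projN c x z := by
  simp only [projN, quad_smul_right]
  module

end Derivatives

/-! ### Totally umbilical hypersurfaces of the space form -/

section Umbilical

open Filter Topology

variable {n : ℕ} {c : ℝ} {M : Set (Amb n)} {ξ : Amb n → Amb n}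

namespace IsUmbilicalHypersurface

theorem quad_normal (hM : IsUmbilicalHypersurface c (spaceForm n c) (projN c) 2 M ξ) {p : Amb n}
    (hp : p ∈ M) : quad c p (ξ p) = 0 :=
  quad_eq_zero_of_mem_tangentTo subset_rfl (hM.tangent p hp)

theorem quad_tangent (hM : IsUmbilicalHypersurface c (spaceForm n c) (projN c) 2 M ξ)
    {p v : Amb n} (hv : v ∈ tangentTo M p) : quad c p v = 0 :=
  quad_eq_zero_of_mem_tangentTo hM.subset hv

theorem hasFDerivAt_normal (hM : IsUmbilicalHypersurface c (spaceForm n c) (projN c) 2 M ξ)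
    {p : Amb n} (hp : p ∈ M) : HasFDerivAt ξ (fderiv ℝ ξ p) p :=
  ((hM.smooth p hp).differentiableAt (by simp)).hasFDerivAt

/-- The derivative of the unit normal has no component along the position vector. -/
theorem quad_fderiv_normal (hM : IsUmbilicalHypersurface c (spaceForm n c) (projN c) 2 M ξ)
    {p v : Amb n} (hp : p ∈ M) (hv : v ∈ tangentTo M p) : quad c p (fderiv ℝ ξ p v) = 0 := by
  have h := hv (fun x => quad c x (ξ x)) (ContDiffAt.quad contDiffAt_id (hM.smooth p hp))
    (eventually_nhdsWithin_of_forall fun x hx => hM.quad_normal hx)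
  rw [(HasFDerivAt.quad (c := c) (f := fun x => x)
    (hasFDerivAt_id p) (hM.hasFDerivAt_normal hp)).fderiv] at h
  simp only [add_apply, ContinuousLinearMap.comp_apply, quadL_apply,
    ContinuousLinearMap.flip_apply, ContinuousLinearMap.id_apply] at h
  rwa [quad_eq_mul_met_of_tangent (hM.subset hp) (hM.quad_tangent hv), met_comm v,
    hM.normal p hp v hv, mul_zero, add_zero] at h

/-- The derivative of `ξ` is already tangent to the space form, so the projection in the umbilicity
condition can be dropped. -/
theorem exists_fderiv_normal (hM : IsUmbilicalHypersurface c (spaceForm n c) (projN c) 2 M ξ)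
    {p : Amb n} (hp : p ∈ M) : ∃ l : ℝ, ∀ v ∈ tangentTo M p, fderiv ℝ ξ p v = -(l • v) := by
  obtain ⟨l, hl⟩ := hM.umbilic p hp
  refine ⟨l, fun v hv => ?_⟩
  rw [← hl v hv, projN_of_tangent (hM.quad_fderiv_normal hp hv)]

/-- The principal curvature of a connected totally umbilical hypersurface of dimension at least two
is constant. -/
theorem exists_const_curvature (hM : IsUmbilicalHypersurface c (spaceForm n c) (projN c) 2 M ξ)
    (hMc : IsPreconnected M) (hn : 3 ≤ n) :
    ∃ l : ℝ, ∀ p ∈ M, ∀ v ∈ tangentTo M p, fderiv ℝ ξ p v = -(l • v) := by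
  rcases M.eq_empty_or_nonempty with rfl | ⟨p₀, hp₀⟩
  · exact ⟨0, by simp⟩
  choose! l hl using fun p (hp : p ∈ M) => hM.exists_fderiv_normal hp
  refine ⟨l p₀, fun p hp => ?_⟩
  suffices h : l p₀ = l p by rw [h]; exact hl p hp
  refine eq_of_eventually_nhdsWithin_eq hMc (fun q hq => ?_) hp₀ hp
  obtain ⟨φ, π, hφ, h0, hmap, hπ⟩ := hM.submanifold.exists_parametrization hq
  rw [← hmap, eventually_map]
  have hV : 2 ≤ Module.finrank ℝ (tangentTo M q) := by
    have := hM.submanifold.finrank_tangentTo hq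
    omega
  have hmem : ∀ᶠ y in 𝓝 0, φ y ∈ M := by
    rw [← eventually_map (P := fun x => x ∈ M), hmap]
    exact self_mem_nhdsWithin
  -- In the chart `φ` with left inverse `π`, up to the translation by `q`, the map `π ∘ ξ ∘ φ` has
  -- differential `-l` times the identity, because `π ∘ dφ = id`.
  have hΨ : ContDiffAt ℝ 2 (fun y => π (ξ (φ y))) 0 := by
    have h1 : ContDiffAt ℝ 2 ξ (φ 0) := by
      rw [h0]
      exact_mod_cast contDiffAt_infty.1 (hM.smooth q hq) 2
    exact π.contDiff.contDiffAt.comp 0 (h1.comp 0 hφ)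
  have h := eventually_eq_of_fderiv_eq_smul_id hV (μ := fun y => -l (φ y)) hΨ ?_
  · filter_upwards [h] with y hy
    rw [h0] at hy
    exact neg_injective hy
  · filter_upwards [hφ.eventually (by simp), hmem.eventually_nhds, hπ.eventually_nhds]
      with y h1 h2 h3 w
    have hd : HasFDerivAt φ (fderiv ℝ φ y) y := (h1.differentiableAt (by simp)).hasFDerivAt
    have hyM : φ y ∈ M := h2.self_of_nhds
    have h4 := π.hasFDerivAt.comp y ((hM.hasFDerivAt_normal hyM).comp y hd)
    have h5 : HasFDerivAt (fun y => π (φ y - q)) (π.comp (fderiv ℝ φ y)) y :=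
      π.hasFDerivAt.comp y (hd.sub_const q)
    have h6 := h5.unique ((hasFDerivAt_id y).congr_of_eventuallyEq h3)
    have h7 : π (fderiv ℝ φ y w) = w := by simpa using DFunLike.congr_fun h6 w
    have h8 : fderiv ℝ (fun y => π (ξ (φ y))) y = _ := h4.fderiv
    rw [h8]
    simp only [ContinuousLinearMap.comp_apply]
    rw [hl _ hyM _ (mem_tangentTo_of_hasFDerivAt hd h2 w), map_neg, map_smul, h7, neg_smul]

/-- A first integral of totally umbilical hypersurfaces. -/
theorem met_sub_normal_add_const
    (hM : IsUmbilicalHypersurface c (spaceForm n c) (projN c) 2 M ξ)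
    (hMc : IsPreconnected M) {l : ℝ}
    (hl : ∀ p ∈ M, ∀ v ∈ tangentTo M p, fderiv ℝ ξ p v = -(l • v)) (o : Amb n) {p q : Amb n}
    (hp : p ∈ M) (hq : q ∈ M) :
    met c (p - o) (ξ p) + l / 2 * met c (p - o) (p - o) =
      met c (q - o) (ξ q) + l / 2 * met c (q - o) (q - o) := by
  refine eq_of_eventually_nhdsWithin_eq hMc
    (f := fun x => met c (x - o) (ξ x) + l / 2 * met c (x - o) (x - o)) (fun q hq => ?_) hp hq
  obtain ⟨φ, π, hφ, h0, hmap, -⟩ := hM.submanifold.exists_parametrization hq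
  have hmem : ∀ᶠ y in 𝓝 0, φ y ∈ M := by
    rw [← eventually_map (P := fun x => x ∈ M), hmap]
    exact self_mem_nhdsWithin
  rw [← hmap, eventually_map]
  have h := eventually_eq_of_hasFDerivAt_zero
    (f := fun y => met c (φ y - o) (ξ (φ y)) + l / 2 * met c (φ y - o) (φ y - o)) (y₀ := 0) ?_
  · filter_upwards [h] with y hy
    rwa [h0] at hy
  · filter_upwards [hφ.eventually (by simp), hmem.eventually_nhds] with y h1 h2
    have hd : HasFDerivAt φ (fderiv ℝ φ y) y := (h1.differentiableAt (by simp)).hasFDerivAt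
    have hyM : φ y ∈ M := h2.self_of_nhds
    have h4 := (hM.hasFDerivAt_normal hyM).comp y hd
    have h5 := (HasFDerivAt.met (c := c) (hd.sub_const o) h4).add
      ((HasFDerivAt.met (c := c) (hd.sub_const o) (hd.sub_const o)).const_mul (l / 2))
    refine h5.congr_fderiv ?_
    ext1 w
    have h6 := mem_tangentTo_of_hasFDerivAt hd h2 w
    simp only [add_apply, ContinuousLinearMap.comp_apply,
      ContinuousLinearMap.flip_apply, metL_apply, smul_apply, smul_eq_mul,
      zero_apply, Function.comp_apply]
    -- For `v` tangent to `M` at `x`, `⟨v, ξ⟩ = 0`, and the term `-l ⟨x - o, v⟩` from Weingarten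
    -- cancels the derivative of the quadratic term.
    rw [hl _ hyM _ h6, met_neg_right, met_smul_right, met_comm _ (ξ (φ y)),
      hM.normal _ hyM _ h6, met_comm (fderiv ℝ φ y w) (φ y - o)]
    ring

/-- The tangent space of a hypersurface of the space form is the orthogonal complement of the unit
normal. -/
theorem mem_tangentTo_iff (hM : IsUmbilicalHypersurface c (spaceForm n c) (projN c) 2 M ξ)
    {p v : Amb n} (hp : p ∈ M) :
    v ∈ tangentTo M p ↔ quad c p v = 0 ∧ met c (ξ p) v = 0 := by
  refine ⟨fun hv => ⟨hM.quad_tangent hv, hM.normal p hp v hv⟩, fun hv => ?_⟩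
  let L : Amb n →ₗ[ℝ] ℝ × ℝ :=
    ((quadL c p : Amb n →L[ℝ] ℝ).prod (metL c (ξ p)) : Amb n →L[ℝ] ℝ × ℝ)
  have hL : ∀ w, L w = (quad c p w, met c (ξ p) w) := fun w => by
    simp [L, quadL_apply, metL_apply]
  have hsurj : Function.Surjective L := by
    rintro ⟨a, b⟩
    -- `L p = (1, ⟨ξ, p⟩)` and `L (ξ p) = (0, 1)`. The correction by `⟨ξ, p⟩` matters for `c = 0`,
    -- where position and tangent vectors need not be orthogonal.
    refine ⟨a • p + (b - a * met c (ξ p) p) • ξ p, ?_⟩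
    have h1 : quad c p p = 1 := (hM.subset hp).1
    rw [hL, quad_add_right, quad_smul_right, quad_smul_right, met_add_right, met_smul_right,
      met_smul_right, h1, hM.quad_normal hp, hM.unit p hp]
    ext <;> simp
  have hle : tangentTo M p ≤ L.ker := fun w hw => by
    rw [LinearMap.mem_ker, hL, hM.quad_tangent hw, hM.normal p hp w hw]
    rfl
  have hrank := L.finrank_range_add_finrank_ker
  rw [LinearMap.range_eq_top.2 hsurj, finrank_top, finrank_amb] at hrank
  have h2 := hM.submanifold.finrank_tangentTo hp
  have heq : tangentTo M p = L.ker := by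
    refine Submodule.eq_of_le_of_finrank_eq hle ?_
    simp only [Module.finrank_prod, Module.finrank_self] at hrank
    omega
  rw [heq, LinearMap.mem_ker, hL, hv.1, hv.2]
  rfl

end IsUmbilicalHypersurface

end Umbilical

/-! ### Cutting submanifolds by an equation; the space form as a submanifold -/

section Hypersurfaces

open Filter Topology

variable {n k : ℕ} {c : ℝ}

theorem tangentTo_congr {X Y U : Set (Amb n)} {p : Amb n} (hU : IsOpen U) (hp : p ∈ U)
    (h : X ∩ U = Y ∩ U) : tangentTo X p = tangentTo Y p := by
  have h1 : 𝓝[X] p = 𝓝[Y] p := by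
    rw [← nhdsWithin_inter_of_mem' (s := X) (mem_nhdsWithin_of_mem_nhds (hU.mem_nhds hp)),
      ← nhdsWithin_inter_of_mem' (s := Y) (mem_nhdsWithin_of_mem_nhds (hU.mem_nhds hp)), h]
  ext v
  change (∀ f : Amb n → ℝ, _ → _ → _) ↔ (∀ f : Amb n → ℝ, _ → _ → _)
  rw [h1]

/-- Cutting a submanifold by a further independent equation. -/
theorem IsSubmanifold.exists_cons {X : Set (Amb n)} (hX : IsSubmanifold k X) {p : Amb n}
    (hp : p ∈ X) {g : Amb n → ℝ} (hg : ContDiff ℝ ∞ g) (hgp : g p = 0) {w : Amb n}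
    (hw : w ∈ tangentTo X p) (hgw : fderiv ℝ g p w ≠ 0) :
    (∃ U : Set (Amb n), IsOpen U ∧ p ∈ U ∧ ∃ F : Amb n → (Fin (k + 1) → ℝ),
      ContDiffOn ℝ ∞ F U ∧ Function.Surjective (fderiv ℝ F p) ∧
        (X ∩ {x | g x = 0}) ∩ U = {x ∈ U | F x = 0}) ∧
      ∀ v, v ∈ tangentTo (X ∩ {x | g x = 0}) p ↔ v ∈ tangentTo X p ∧ fderiv ℝ g p v = 0 := by
  obtain ⟨U, hU, hpU, F, hF, hsurj, hXU⟩ := hX p hp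
  have hT : ∀ v, v ∈ tangentTo X p ↔ fderiv ℝ F p v = 0 := fun v =>
    SpaceFormPMC.mem_tangentTo_iff hU hpU hp hF hsurj hXU
  let G : Amb n → Fin (k + 1) → ℝ := fun x => Fin.cons (g x) (F x)
  have hG : ContDiffOn ℝ ∞ G U := by
    rw [contDiffOn_pi]
    intro i
    refine Fin.cases ?_ (fun j => ?_) i
    · exact hg.contDiffOn
    · exact contDiffOn_pi.1 hF j
  have hFd : HasFDerivAt F (fderiv ℝ F p) p :=
    ((hF.contDiffAt (hU.mem_nhds hpU)).differentiableAt (by simp)).hasFDerivAt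
  have hgd : HasFDerivAt g (fderiv ℝ g p) p := (hg.contDiffAt.differentiableAt (by simp)).hasFDerivAt
  have hGd : HasFDerivAt G (fderiv ℝ G p) p :=
    ((hG.contDiffAt (hU.mem_nhds hpU)).differentiableAt (by simp)).hasFDerivAt
  have hGv : ∀ v, fderiv ℝ G p v = Fin.cons (fderiv ℝ g p v) (fderiv ℝ F p v) := by
    intro v
    ext i
    have hi := hasFDerivAt_pi'.1 hGd i
    refine Fin.cases (fun hi => ?_) (fun j hi => ?_) i hi
    · exact DFunLike.congr_fun (hi.unique hgd) v
    · exact DFunLike.congr_fun (hi.unique (hasFDerivAt_pi'.1 hFd j)) v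
  have hGs : Function.Surjective (fderiv ℝ G p) := by
    intro z
    obtain ⟨v, hv⟩ := hsurj (Fin.tail z)
    -- Moving along `w`, which `dF` annihilates, adjusts the `g`-component alone.
    refine ⟨v + ((z 0 - fderiv ℝ g p v) / fderiv ℝ g p w) • w, ?_⟩
    rw [hGv, map_add, map_add, map_smul, map_smul, (hT w).1 hw, hv, smul_zero, add_zero, smul_eq_mul,
      div_mul_cancel₀ _ hgw, add_sub_cancel, Fin.cons_self_tail]
  have hlevel : (X ∩ {x | g x = 0}) ∩ U = {x ∈ U | G x = 0} := by
    ext x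
    have h1 : x ∈ X ∩ U ↔ x ∈ U ∧ F x = 0 := by rw [hXU]; rfl
    have h2 : G x = 0 ↔ g x = 0 ∧ F x = 0 := by
      constructor
      · intro h
        exact ⟨congrFun h 0, funext fun j => congrFun h j.succ⟩
      · rintro ⟨h, h'⟩
        ext i
        refine Fin.cases ?_ (fun j => ?_) i
        · exact h
        · exact congrFun h' j
    simp only [Set.mem_inter_iff, Set.mem_ofPred_eq] at h1 ⊢
    rw [h2]
    tauto
  refine ⟨⟨U, hU, hpU, G, hG, hGs, hlevel⟩, fun v => ?_⟩
  rw [SpaceFormPMC.mem_tangentTo_iff hU hpU (show p ∈ X ∩ {x | g x = 0} from ⟨hp, hgp⟩) hG hGs hlevel, hGv, hT]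
  constructor
  · intro h
    exact ⟨funext fun j => congrFun h j.succ, congrFun h 0⟩
  · rintro ⟨h, h'⟩
    ext i
    refine Fin.cases ?_ (fun j => ?_) i
    · exact h'
    · exact congrFun h j

/-- The open set in which the space form is a regular level set. -/
theorem isOpen_sheet : IsOpen {x : Amb n | c ≤ 0 → 0 < x.1} := by
  by_cases hc : c ≤ 0
  · simpa [hc] using isOpen_lt continuous_const continuous_fst
  · simp [hc]

theorem hasFDerivAt_quad_self (p : Amb n) :
    HasFDerivAt (fun x : Amb n => quad c x x - 1)
      ((quadL c p) + ((quadL c).flip p)) p :=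
  (HasFDerivAt.quad (f := fun x => x) (g := fun x => x) (hasFDerivAt_id p)
    (hasFDerivAt_id p)).sub_const 1

theorem isSubmanifold_spaceForm : IsSubmanifold 1 (spaceForm n c) := by
  intro p hp
  have hd : HasFDerivAt (fun (x : Amb n) (_ : Fin 1) => quad c x x - 1)
      (ContinuousLinearMap.pi fun _ : Fin 1 => (quadL c p) + ((quadL c).flip p)) p :=
    hasFDerivAt_pi.2 fun _ => hasFDerivAt_quad_self p
  refine ⟨_, isOpen_sheet (c := c), hp.2, fun x _ => quad c x x - 1, ?_, ?_, ?_⟩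
  · refine contDiffOn_pi.2 fun _ x _ => ContDiffAt.contDiffWithinAt ?_
    exact (ContDiffAt.quad contDiffAt_id contDiffAt_id).sub contDiffAt_const
  · rw [hd.fderiv]
    intro z
    have h1 : quad c p p = 1 := hp.1
    refine ⟨(z 0 / 2) • p, ?_⟩
    ext i
    fin_cases i
    simp [quadL_apply, h1]
    ring
  · ext x
    simp only [spaceForm, Set.mem_inter_iff, Set.mem_ofPred_eq, funext_iff, Pi.zero_apply,
      sub_eq_zero, Fin.forall_fin_one]
    tauto

theorem mem_tangentTo_spaceForm_iff {p v : Amb n} (hp : p ∈ spaceForm n c) :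
    v ∈ tangentTo (spaceForm n c) p ↔ quad c p v = 0 := by
  refine ⟨quad_eq_zero_of_mem_tangentTo subset_rfl, fun hv => ?_⟩
  let L : Amb n →ₗ[ℝ] ℝ := (quadL c p : Amb n →L[ℝ] ℝ)
  have hL : ∀ w, L w = quad c p w := fun w => quadL_apply p w
  have hsurj : Function.Surjective L := by
    intro a
    have h1 : quad c p p = 1 := hp.1
    exact ⟨a • p, by rw [hL, quad_smul_right, h1, mul_one]⟩
  have hle : tangentTo (spaceForm n c) p ≤ L.ker := fun w hw => by
    rw [LinearMap.mem_ker, hL, quad_eq_zero_of_mem_tangentTo subset_rfl hw]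
  have hrank := L.finrank_range_add_finrank_ker
  rw [LinearMap.range_eq_top.2 hsurj, finrank_top, finrank_amb, Module.finrank_self] at hrank
  have h2 := isSubmanifold_spaceForm.finrank_tangentTo hp
  have heq : tangentTo (spaceForm n c) p = L.ker :=
    Submodule.eq_of_le_of_finrank_eq hle (by omega)
  rw [heq, LinearMap.mem_ker, hL, hv]

end Hypersurfaces

/-! ### Geodesic spheres as level sets of the chord length -/

section Sphere

open Filter Topology

variable {n : ℕ} {c : ℝ} {o : Amb n} {r : ℝ}

/-- The squared chord length of the geodesic sphere of radius `r`. -/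
noncomputable def chordSq (c : ℝ) (o : Amb n) (r : ℝ) : ℝ :=
  (cs c r - 1) ^ 2 * met c o o + sn c r ^ 2

/-- Either `c ≠ 0` and position is orthogonal to tangent vectors, or `c = 0` and `cs = 1`. This lets
one computation cover all curvatures. -/
theorem one_sub_cs_mul_met {x v : Amb n} (hv : quad c x v = 0) : (1 - cs c r) * met c x v = 0 := by
  by_cases hc : c = 0
  · simp [hc, cs_zero_curv]
  · rw [quad_eq_mul_met hc] at hv
    simp [(mul_eq_zero.1 hv).resolve_left hc]

theorem fst_eq_one {x : Amb n} (hx : x ∈ spaceForm n 0) : x.1 = 1 := by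
  have h0 : 0 < x.1 := hx.2 le_rfl
  have h1 : x.1 * x.1 = 1 := by simpa [quad] using hx.1
  nlinarith

theorem geodSphere_quad {x : Amb n} (ho : o ∈ spaceForm n c) (hx : x ∈ geodSphere c o r) :
    quad c x x = 1 ∧ met c (x - o) (x - o) = chordSq c o r := by
  obtain ⟨v, ⟨hv, hv1⟩, rfl⟩ := hx
  have h1 : quad c o o = 1 := ho.1
  have h2 : quad c v v = c := by
    rw [quad_eq_mul_met_of_tangent ho hv, hv1, mul_one]
  have h3 := one_sub_cs_mul_met (r := r) hv
  constructor
  · rw [geod]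
    simp only [quad_add_left, quad_add_right, quad_smul_left, quad_smul_right, h1, hv, h2,
      quad_comm v o]
    linarith [cs_sq_add_mul_sn_sq (c := c) r]
  · have : geod c o v r - o = (cs c r - 1) • o + sn c r • v := by rw [geod]; module
    rw [this, chordSq]
    simp only [met_add_left, met_add_right, met_smul_left, met_smul_right, hv1, met_comm v o]
    linear_combination (-2 * sn c r) * h3

/-- For `c ≠ 0` expanding the chord determines `quad c o x`, as in the law of cosines, and the two
lengths follow from `cs² + c sn² = 1`. For `c = 0` both vectors are `x - o`. -/
theorem quad_of_chordSq {x : Amb n} (ho : o ∈ spaceForm n c) (hx : x ∈ spaceForm n c)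
    (h : met c (x - o) (x - o) = chordSq c o r) :
    quad c o x = cs c r ∧ met c (x - cs c r • o) (x - cs c r • o) = sn c r ^ 2 ∧
      met c (cs c r • x - o) (cs c r • x - o) = sn c r ^ 2 := by
  by_cases hc : c = 0
  · subst hc
    have h1 := fst_eq_one ho
    have h2 := fst_eq_one hx
    simp only [chordSq, cs_zero_curv, sub_self, one_smul] at h ⊢
    refine ⟨by simp [quad, h1, h2], ?_, ?_⟩ <;> · rw [h]; ring
  · have h1 : c * met c o o = 1 := by rw [← quad_eq_mul_met hc]; exact ho.1
    have h2 : c * met c x x = 1 := by rw [← quad_eq_mul_met hc]; exact hx.1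
    have h3 := cs_sq_add_mul_sn_sq (c := c) r
    rw [quad_eq_mul_met hc]
    simp only [chordSq, met_sub_left, met_sub_right, met_smul_left, met_smul_right,
      met_comm x o] at h ⊢
    have h4 : c * met c o x = cs c r := by
      linear_combination (-c / 2) * h + h2 / 2 + (1 - (cs c r - 1) ^ 2) / 2 * h1 - h3 / 2
    refine ⟨h4, ?_, ?_⟩
    · refine mul_left_cancel₀ hc ?_
      linear_combination h2 - 2 * cs c r * h4 + cs c r ^ 2 * h1 - h3
    · refine mul_left_cancel₀ hc ?_
      linear_combination cs c r ^ 2 * h2 - 2 * cs c r * h4 + h1 - h3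

theorem mem_geodSphere_iff {x : Amb n} (ho : o ∈ spaceForm n c) (hx : x ∈ spaceForm n c)
    (hs : 0 < sn c r) :
    x ∈ geodSphere c o r ↔ met c (x - o) (x - o) = chordSq c o r := by
  refine ⟨fun h => (geodSphere_quad ho h).2, fun h => ?_⟩
  obtain ⟨h1, h2, -⟩ := quad_of_chordSq ho hx h
  have ho1 : quad c o o = 1 := ho.1
  -- The initial velocity, obtained by solving `x = cs o + sn v` for `v`.
  refine ⟨(sn c r)⁻¹ • (x - cs c r • o), ⟨?_, ?_⟩, ?_⟩
  · rw [quad_smul_right, quad_sub_right, quad_smul_right, h1, ho1]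
    ring
  · rw [met_smul_left, met_smul_right, h2]
    field_simp
  · rw [geod, smul_smul, mul_inv_cancel₀ hs.ne']
    module

theorem hasFDerivAt_outNormal (x : Amb n) :
    HasFDerivAt (outNormal c o r)
      (((sn c r)⁻¹ * cs c r) • ContinuousLinearMap.id ℝ (Amb n)) x := by
  have h := (((hasFDerivAt_id (𝕜 := ℝ) x).const_smul (cs c r)).sub_const o).const_smul ((sn c r)⁻¹)
  rw [smul_smul] at h
  exact h

/-- The defining equation of the geodesic sphere in the space form. -/
noncomputable def chordFun (c : ℝ) (o : Amb n) (r : ℝ) (x : Amb n) : ℝ :=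
  met c (x - o) (x - o) - chordSq c o r

theorem contDiff_chordFun : ContDiff ℝ ∞ (chordFun c o r) :=
  contDiff_iff_contDiffAt.2 fun _ => (ContDiffAt.met (contDiffAt_id.sub contDiffAt_const)
    (contDiffAt_id.sub contDiffAt_const)).sub contDiffAt_const

theorem fderiv_chordFun (x v : Amb n) : fderiv ℝ (chordFun c o r) x v = 2 * met c (x - o) v := by
  have h := (HasFDerivAt.met (c := c) (f := fun x => x - o) (g := fun x => x - o)
    ((hasFDerivAt_id x).sub_const o) ((hasFDerivAt_id x).sub_const o)).sub_const (chordSq c o r)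
  have h' : fderiv ℝ (chordFun c o r) x = _ := h.fderiv
  rw [h']
  simp only [add_apply, ContinuousLinearMap.comp_apply, ContinuousLinearMap.flip_apply,
    ContinuousLinearMap.id_apply, metL_apply, met_comm v (x - o)]
  ring

/-- Since `cs x - o = (x - o) - (1 - cs) x`, the normal pairs with tangent vectors like a multiple
of the chord, that is, of the gradient of `chordFun`. -/
theorem met_outNormal {x v : Amb n} (hv : quad c x v = 0) :
    met c (outNormal c o r x) v = (sn c r)⁻¹ * met c (x - o) v := by
  have := one_sub_cs_mul_met (r := r) hv
  rw [outNormal, met_smul_left, met_sub_left, met_sub_left, met_smul_left]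
  linear_combination (-(sn c r)⁻¹) * this

theorem fderiv_chordFun_eq {x v : Amb n} (hs : 0 < sn c r) (hv : quad c x v = 0) :
    fderiv ℝ (chordFun c o r) x v = 2 * sn c r * met c (outNormal c o r x) v := by
  rw [fderiv_chordFun, met_outNormal hv]
  field_simp

theorem outNormal_unit {x : Amb n} (hs : 0 < sn c r) (ho : o ∈ spaceForm n c)
    (hx : x ∈ spaceForm n c) (hxS : x ∈ geodSphere c o r) :
    quad c x (outNormal c o r x) = 0 ∧ met c (outNormal c o r x) (outNormal c o r x) = 1 := by
  obtain ⟨h1, -, h2⟩ := quad_of_chordSq ho hx (geodSphere_quad ho hxS).2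
  have hx1 : quad c x x = 1 := hx.1
  constructor
  · rw [outNormal, quad_smul_right, quad_sub_right, quad_smul_right, hx1, quad_comm x o, h1]
    ring
  · rw [outNormal, met_smul_left, met_smul_right, h2]
    field_simp

theorem mem_tangentTo_geodSphere_iff {x v : Amb n} (hs : 0 < sn c r) (ho : o ∈ spaceForm n c)
    (hx : x ∈ spaceForm n c) (hxS : x ∈ geodSphere c o r) :
    v ∈ tangentTo (geodSphere c o r) x ↔ quad c x v = 0 ∧ met c (outNormal c o r x) v = 0 := by
  obtain ⟨h1, h2⟩ := outNormal_unit hs ho hx hxS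
  -- `geodSphere_quad` gives no sign of the first coordinate, so the two sets are compared only
  -- inside the open sheet around `x`.
  have h3 : tangentTo (geodSphere c o r) x =
      tangentTo (spaceForm n c ∩ {x | chordFun c o r x = 0}) x := by
    refine tangentTo_congr (isOpen_sheet (c := c)) hx.2 ?_
    ext y
    constructor
    · rintro ⟨hy, hyU⟩
      obtain ⟨h4, h5⟩ := geodSphere_quad ho hy
      exact ⟨⟨⟨h4, hyU⟩, sub_eq_zero.2 h5⟩, hyU⟩
    · rintro ⟨⟨hy, hy'⟩, hyU⟩
      exact ⟨(mem_geodSphere_iff ho hy hs).2 (sub_eq_zero.1 hy'), hyU⟩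
  rw [h3, (isSubmanifold_spaceForm.exists_cons hx contDiff_chordFun
    (sub_eq_zero.2 (geodSphere_quad ho hxS).2) ((mem_tangentTo_spaceForm_iff hx).2 h1)
    (by rw [fderiv_chordFun_eq hs h1, h2]; positivity)).2, mem_tangentTo_spaceForm_iff hx]
  refine and_congr_right fun hv => ?_
  rw [fderiv_chordFun_eq hs hv]
  simp [hs.ne']

end Sphere

/-! ### The intersection with the geodesic sphere; contact angles -/

section Intersection

variable {n : ℕ} {c : ℝ} {o : Amb n} {r : ℝ} {M : Set (Amb n)} {ξ : Amb n → Amb n}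

theorem projM_of_tangent {x v : Amb n} (hv : quad c x v = 0) (hξ : met c (ξ x) v = 0) :
    projM c ξ x v = v := by
  rw [projM, projN_of_tangent hv, met_comm v, hξ, zero_smul, sub_zero]

theorem projM_add (x z w : Amb n) : projM c ξ x (z + w) = projM c ξ x z + projM c ξ x w := by
  simp only [projM, projN_add, met_add_left]
  module

theorem projM_smul (a : ℝ) (x z : Amb n) : projM c ξ x (a • z) = a • projM c ξ x z := by
  simp only [projM, projN_smul, met_smul_left]
  module

namespace IsUmbilicalHypersurface

/-- A connected totally umbilical hypersurface meets a geodesic sphere at a constant angle. -/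
theorem exists_met_outNormal_eq
    (hM : IsUmbilicalHypersurface c (spaceForm n c) (projN c) 2 M ξ) (hMc : IsPreconnected M)
    (ho : o ∈ spaceForm n c) {l : ℝ}
    (hl : ∀ p ∈ M, ∀ v ∈ tangentTo M p, fderiv ℝ ξ p v = -(l • v)) :
    ∃ κ : ℝ, ∀ x ∈ M ∩ geodSphere c o r, met c (outNormal c o r x) (ξ x) = κ := by
  rcases (M ∩ geodSphere c o r).eq_empty_or_nonempty with h | ⟨x₀, hx₀⟩
  · exact ⟨0, by simp [h]⟩
  refine ⟨met c (outNormal c o r x₀) (ξ x₀), fun x hx => ?_⟩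
  rw [met_outNormal (hM.quad_normal hx.1), met_outNormal (hM.quad_normal hx₀.1)]
  have h := hM.met_sub_normal_add_const hMc hl o hx.1 hx₀.1
  rw [(geodSphere_quad ho hx.2).2, (geodSphere_quad ho hx₀.2).2] at h
  rw [add_right_cancel h]

theorem inter_geodSphere_eq (hM : IsUmbilicalHypersurface c (spaceForm n c) (projN c) 2 M ξ)
    (hs : 0 < sn c r) (ho : o ∈ spaceForm n c) :
    M ∩ geodSphere c o r = M ∩ {x | chordFun c o r x = 0} := by
  ext x
  refine and_congr_right fun hx => ?_
  rw [mem_geodSphere_iff ho (hM.subset hx) hs]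
  exact sub_eq_zero.symm

/-- The component of `outNormal` tangent to `M`, at an intersection point with `κ = ⟨n, ξ⟩`. -/
theorem outNormal_sub_mem (hM : IsUmbilicalHypersurface c (spaceForm n c) (projN c) 2 M ξ)
    (hs : 0 < sn c r) (ho : o ∈ spaceForm n c) {κ : ℝ} {x : Amb n}
    (hx : x ∈ M ∩ geodSphere c o r) (hκ : met c (outNormal c o r x) (ξ x) = κ) :
    outNormal c o r x - κ • ξ x ∈ tangentTo M x ∧
      met c (outNormal c o r x - κ • ξ x) (outNormal c o r x - κ • ξ x) = 1 - κ ^ 2 ∧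
      met c (outNormal c o r x) (outNormal c o r x - κ • ξ x) = 1 - κ ^ 2 := by
  obtain ⟨h1, h2⟩ := outNormal_unit hs ho (hM.subset hx.1) hx.2
  have h3 := hM.unit x hx.1
  refine ⟨(hM.mem_tangentTo_iff hx.1).2 ⟨?_, ?_⟩, ?_, ?_⟩
  · rw [quad_sub_right, quad_smul_right, h1, hM.quad_normal hx.1]
    ring
  · rw [met_sub_right, met_smul_right, h3, met_comm, hκ]
    ring
  · simp only [met_sub_left, met_sub_right, met_smul_right, met_smul_left, h2, h3, hκ,
      met_comm (ξ x) (outNormal c o r x)]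
    ring
  · rw [met_sub_right, met_smul_right, h2, hκ]
    ring

/-- Transversality: along `n - κ ξ`, which is tangent to `M`, the derivative of `chordFun` is `2 sn
(1 - κ²) > 0`. -/
theorem exists_levelSet_inter (hM : IsUmbilicalHypersurface c (spaceForm n c) (projN c) 2 M ξ)
    (hs : 0 < sn c r) (ho : o ∈ spaceForm n c) {κ : ℝ} (hκ1 : κ ^ 2 < 1) {x : Amb n}
    (hx : x ∈ M ∩ geodSphere c o r) (hκ : met c (outNormal c o r x) (ξ x) = κ) :
    (∃ U : Set (Amb n), IsOpen U ∧ x ∈ U ∧ ∃ F : Amb n → (Fin 3 → ℝ),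
      ContDiffOn ℝ ∞ F U ∧ Function.Surjective (fderiv ℝ F x) ∧
        (M ∩ geodSphere c o r) ∩ U = {x ∈ U | F x = 0}) ∧
      ∀ v, v ∈ tangentTo (M ∩ geodSphere c o r) x ↔
        v ∈ tangentTo M x ∧ met c (outNormal c o r x) v = 0 := by
  obtain ⟨h1, h2, h3⟩ := hM.outNormal_sub_mem hs ho hx hκ
  rw [hM.inter_geodSphere_eq hs ho]
  have h4 : 0 < 1 - κ ^ 2 := by linarith
  obtain ⟨h5, h6⟩ := hM.submanifold.exists_cons hx.1 contDiff_chordFun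
    (sub_eq_zero.2 (geodSphere_quad ho hx.2).2) h1
    (by rw [fderiv_chordFun_eq hs (hM.quad_tangent h1), h3]; positivity)
  refine ⟨h5, fun v => (h6 v).trans (and_congr_right fun hv => ?_)⟩
  rw [fderiv_chordFun_eq hs (hM.quad_tangent hv)]
  simp [hs.ne']

/-- A transverse intersection of a totally umbilical hypersurface with a geodesic sphere is totally
umbilical. -/
theorem inter_geodSphere (hM : IsUmbilicalHypersurface c (spaceForm n c) (projN c) 2 M ξ)
    (hs : 0 < sn c r) (ho : o ∈ spaceForm n c) {l κ : ℝ}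
    (hl : ∀ p ∈ M, ∀ v ∈ tangentTo M p, fderiv ℝ ξ p v = -(l • v)) (hκ1 : κ ^ 2 < 1)
    (hκ : ∀ x ∈ M ∩ geodSphere c o r, met c (outNormal c o r x) (ξ x) = κ) :
    IsUmbilicalHypersurface c M (projM c ξ) 3 (M ∩ geodSphere c o r)
      (fun x => (√(1 - κ ^ 2))⁻¹ • (outNormal c o r x - κ • ξ x)) where
  subset := Set.inter_subset_left
  submanifold x hx := (hM.exists_levelSet_inter hs ho hκ1 hx (hκ x hx)).1
  smooth x hx := by
    have h1 := hM.smooth x hx.1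
    unfold outNormal
    fun_prop
  tangent x hx := Submodule.smul_mem _ _ (hM.outNormal_sub_mem hs ho hx (hκ x hx)).1
  unit x hx := by
    have h4 : 0 < 1 - κ ^ 2 := by linarith
    rw [met_smul_left, met_smul_right, (hM.outNormal_sub_mem hs ho hx (hκ x hx)).2.1]
    have := Real.sq_sqrt h4.le
    have h5 := (Real.sqrt_pos.2 h4).ne'
    field_simp
    linarith
  normal x hx v hv := by
    obtain ⟨h1, h2⟩ := ((hM.exists_levelSet_inter hs ho hκ1 hx (hκ x hx)).2 v).1 hv
    rw [met_smul_left, met_sub_left, met_smul_left, h2, hM.normal x hx.1 v h1]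
    ring
  umbilic x hx := by
    -- On tangent vectors `dn = (cs / sn) id` and `dξ = -l id`, and `κ` is constant, so the
    -- derivative of the normalized `n - κ ξ` is again a multiple of the identity.
    refine ⟨-((√(1 - κ ^ 2))⁻¹ * ((sn c r)⁻¹ * cs c r + κ * l)), fun v hv => ?_⟩
    obtain ⟨h1, h2⟩ := ((hM.exists_levelSet_inter hs ho hκ1 hx (hκ x hx)).2 v).1 hv
    have h3 := ((hasFDerivAt_outNormal (c := c) (o := o) (r := r) x).sub
      ((hM.hasFDerivAt_normal hx.1).const_smul κ)).const_smul (√(1 - κ ^ 2))⁻¹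
    have h4 : fderiv ℝ (fun x => (√(1 - κ ^ 2))⁻¹ • (outNormal c o r x - κ • ξ x)) x = _ :=
      h3.fderiv
    have h5 : fderiv ℝ (fun x => (√(1 - κ ^ 2))⁻¹ • (outNormal c o r x - κ • ξ x)) x v =
        ((√(1 - κ ^ 2))⁻¹ * ((sn c r)⁻¹ * cs c r + κ * l)) • v := by
      rw [h4]
      simp only [smul_apply, sub_apply, ContinuousLinearMap.id_apply, hl x hx.1 v h1]
      module
    rw [h5, projM_smul, projM_of_tangent (hM.quad_tangent h1) (hM.normal x hx.1 v h1), neg_smul,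
      neg_neg]

end IsUmbilicalHypersurface

/-- The maximum that defines the contact angle with a hypersurface of unit normal `m`. -/
theorem isGreatest_contact {x m ν : Amb n} (hx : x ∈ spaceForm n c) {K T : Submodule ℝ (Amb n)}
    (hT : ∀ v ∈ T, quad c x v = 0) (hK : ∀ v, v ∈ K ↔ v ∈ T ∧ met c m v = 0)
    (hm : m ∈ T) (hm1 : met c m m = 1) (hν : ν ∈ T) (hν1 : met c ν ν = 1)
    {A : EuclideanSpace ℝ (Fin 2) →L[ℝ] Amb n}
    (hmA : ∀ t : EuclideanSpace ℝ (Fin 2), t 0 = 0 → met c m (A t) = 0)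
    (hνA : ∀ t : EuclideanSpace ℝ (Fin 2), t 0 = 0 → met c (A t) ν = 0) :
    IsGreatest (insert 0 {s | ∃ y ∈ K, met c y y = 1 ∧
      (∀ t : EuclideanSpace ℝ (Fin 2), t 0 = 0 → met c y (A t) = 0) ∧ s = met c y ν})
      (√(1 - met c m ν ^ 2)) := by
  have hw : met c (ν - met c m ν • m) (ν - met c m ν • m) = 1 - met c m ν ^ 2 := by
    simp only [met_sub_left, met_sub_right, met_smul_left, met_smul_right, hm1, hν1, met_comm ν m]
    ring
  have hwT : ν - met c m ν • m ∈ T := T.sub_mem hν (T.smul_mem _ hm)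
  constructor
  · by_cases h : 0 < 1 - met c m ν ^ 2
    · right
      have hs := (Real.sqrt_pos.2 h).ne'
      have hsq := Real.sq_sqrt h.le
      refine ⟨(√(1 - met c m ν ^ 2))⁻¹ • (ν - met c m ν • m), ?_, ?_, fun t ht => ?_, ?_⟩
      · refine (hK _).2 ⟨T.smul_mem _ hwT, ?_⟩
        rw [met_smul_right, met_sub_right, met_smul_right, hm1]
        ring
      · rw [met_smul_left, met_smul_right, hw]
        field_simp
        linarith
      · rw [met_smul_left, met_sub_left, met_smul_left, hmA t ht, met_comm ν, hνA t ht]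
        ring
      · rw [met_smul_left, met_sub_left, met_smul_left, hν1]
        field_simp
        linarith
    · left
      exact Real.sqrt_eq_zero_of_nonpos (not_lt.1 h)
  · rintro s (rfl | ⟨y, hy, hy1, -, rfl⟩)
    · exact Real.sqrt_nonneg _
    · obtain ⟨hyT, hym⟩ := (hK y).1 hy
      have h := met_sq_le hx (hT y hyT) (hT _ hwT) hy1
      rw [hw, met_sub_right, met_smul_right, met_comm y m, hym, mul_zero, sub_zero] at h
      exact (le_abs_self _).trans (Real.abs_le_sqrt h)

end Intersection

/-! ### Algebra of the normal projection -/

section Perp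

variable {n : ℕ} {c : ℝ}

theorem perp_add (a b z w : Amb n) : perp c a b (z + w) = perp c a b z + perp c a b w := by
  simp only [perp, met_add_left]
  module

theorem perp_smul (s : ℝ) (a b z : Amb n) : perp c a b (s • z) = s • perp c a b z := by
  simp only [perp, met_smul_left]
  module

theorem perp_of_orthogonal {a b z : Amb n} (ha : met c z a = 0) (hb : met c z b = 0) :
    perp c a b z = z := by
  simp [perp, ha, hb]

theorem perp_left {a b : Amb n} (h : met c a a * met c b b - met c a b ^ 2 ≠ 0) :
    perp c a b a = 0 := by
  rw [perp, sub_eq_zero, mul_comm (met c a b) (met c a a), sub_self, zero_smul, add_zero, smul_smul,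
    mul_comm (met c b b), ← sq, inv_mul_cancel₀ h, one_smul]

theorem perp_right {a b : Amb n} (h : met c a a * met c b b - met c a b ^ 2 ≠ 0) :
    perp c a b b = 0 := by
  rw [perp, sub_eq_zero, met_comm b a, mul_comm (met c a b) (met c b b), sub_self, zero_smul,
    zero_add, smul_smul, ← sq, inv_mul_cancel₀ h, one_smul]

theorem met_perp_of_orthogonal {a b m : Amb n} (ha : met c a m = 0) (hb : met c b m = 0)
    (z : Amb n) : met c (perp c a b z) m = met c z m := by
  simp [perp, met_sub_left, met_smul_left, met_add_left, ha, hb]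

end Perp

/-! ### Mean curvature in the space form and in the hypersurface -/

section ParametrizedSurface

open Filter Topology Set

variable {n : ℕ} {c : ℝ} {M : Set (Amb n)} {ξ : Amb n → Amb n}
  {f : EuclideanSpace ℝ (Fin 2) → Amb n} {y : EuclideanSpace ℝ (Fin 2)}

theorem pd_mem_tangentTo (hfM : ∀ z, f z ∈ M) (hy : y ∈ range (𝓡∂ 2))
    (hf : DifferentiableWithinAt ℝ f (range (𝓡∂ 2)) y) (i : Fin 2) :
    pd i f y ∈ tangentTo M (f y) :=
  mem_tangentTo_of_hasFDerivWithinAt hf.hasFDerivWithinAt ((𝓡∂ 2).uniqueDiffOn y hy) hy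
    (Eventually.of_forall hfM) _

theorem eventually_contDiffWithinAt (hy : y ∈ range (𝓡∂ 2))
    (hf : ContDiffWithinAt ℝ 2 f (range (𝓡∂ 2)) y) :
    ∀ᶠ z in 𝓝[range (𝓡∂ 2)] y, ContDiffWithinAt ℝ 2 f (range (𝓡∂ 2)) z := by
  have := hf.eventually (by simp)
  rwa [insert_eq_of_mem hy] at this

theorem contDiffWithinAt_pd (hy : y ∈ range (𝓡∂ 2))
    (hf : ContDiffWithinAt ℝ 2 f (range (𝓡∂ 2)) y) (i : Fin 2) :
    ContDiffWithinAt ℝ 1 (pd i f) (range (𝓡∂ 2)) y :=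
  (hf.fderivWithin_right (m := 1) (𝓡∂ 2).uniqueDiffOn (by norm_num) hy).clm_apply
    contDiffWithinAt_const

/-- The second derivatives of a surface in `M`, in the direction of the unit normal of `M`. -/
theorem met_pd_pd_normal (hM : IsUmbilicalHypersurface c (spaceForm n c) (projN c) 2 M ξ) {l : ℝ}
    (hl : ∀ p ∈ M, ∀ v ∈ tangentTo M p, fderiv ℝ ξ p v = -(l • v)) (hfM : ∀ z, f z ∈ M)
    (hy : y ∈ range (𝓡∂ 2)) (hf : ContDiffWithinAt ℝ 2 f (range (𝓡∂ 2)) y) (i j : Fin 2) :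
    met c (projN c (f y) (pd i (pd j f) y)) (ξ (f y)) = l * met c (pd i f y) (pd j f y) := by
  have hu := (𝓡∂ 2).uniqueDiffOn y hy
  have hfd : HasFDerivWithinAt f (fderivWithin ℝ f (range (𝓡∂ 2)) y) (range (𝓡∂ 2)) y :=
    (hf.differentiableWithinAt (by simp)).hasFDerivWithinAt
  have hjd : HasFDerivWithinAt (pd j f) (fderivWithin ℝ (pd j f) (range (𝓡∂ 2)) y)
      (range (𝓡∂ 2)) y :=
    ((contDiffWithinAt_pd hy hf j).differentiableWithinAt (by simp)).hasFDerivWithinAt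
  have hξd := (hM.hasFDerivAt_normal (hfM y)).comp_hasFDerivWithinAt y hfd
  have hT : ∀ᶠ z in 𝓝[range (𝓡∂ 2)] y, pd j f z ∈ tangentTo M (f z) := by
    filter_upwards [eventually_contDiffWithinAt hy hf, self_mem_nhdsWithin] with z hz hz'
    exact pd_mem_tangentTo hfM hz' (hz.differentiableWithinAt (by simp)) j
  have hTi := pd_mem_tangentTo hfM hy (hf.differentiableWithinAt (by simp)) i
  have hTj := pd_mem_tangentTo hfM hy (hf.differentiableWithinAt (by simp)) j
  have h1 : met c (pd i (pd j f) y) (ξ (f y)) = l * met c (pd i f y) (pd j f y) := by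
    have h := HasFDerivWithinAt.met (c := c) hjd hξd
    have h0 : HasFDerivWithinAt (fun z => met c (pd j f z) ((ξ ∘ f) z))
        (0 : EuclideanSpace ℝ (Fin 2) →L[ℝ] ℝ) (range (𝓡∂ 2)) y :=
      (hasFDerivWithinAt_const (0 : ℝ) _ _).congr_of_eventuallyEq
        (hT.mono fun z hz => (met_comm _ _).trans (hM.normal _ (hfM z) _ hz))
        ((met_comm _ _).trans (hM.normal _ (hfM y) _ hTj))
    have h2 := DFunLike.congr_fun (hu.eq h h0) (EuclideanSpace.single i 1)
    simp only [add_apply, ContinuousLinearMap.comp_apply, metL_apply, zero_apply,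
      ContinuousLinearMap.flip_apply, Function.comp_apply] at h2
    change met c (pd j f y) (fderiv ℝ ξ (f y) (pd i f y)) + met c (pd i (pd j f) y) (ξ (f y)) = 0
      at h2
    rw [hl _ (hfM y) _ hTi, met_neg_right, met_smul_right, met_comm (pd j f y)] at h2
    linarith
  have h2 : quad c (f y) (pd i (pd j f) y) = -(c * met c (pd i f y) (pd j f y)) := by
    have h := (quadL (n := n) c).hasFDerivWithinAt_of_bilinear hfd hjd
    have h0 : HasFDerivWithinAt (fun z => quadL c (f z) (pd j f z))
        (0 : EuclideanSpace ℝ (Fin 2) →L[ℝ] ℝ) (range (𝓡∂ 2)) y :=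
      (hasFDerivWithinAt_const (0 : ℝ) _ _).congr_of_eventuallyEq
        (hT.mono fun z hz => by simpa [quadL_apply] using hM.quad_tangent hz)
        (by simpa [quadL_apply] using hM.quad_tangent hTj)
    have h2 := DFunLike.congr_fun (hu.eq h h0) (EuclideanSpace.single i 1)
    simp only [add_apply, ContinuousLinearMap.precompR_apply, ContinuousLinearMap.precompL_apply,
      quadL_apply, zero_apply] at h2
    change quad c (f y) (pd i (pd j f) y) + quad c (pd i f y) (pd j f y) = 0 at h2
    rw [quad_eq_mul_met_of_tangent (hM.subset (hfM y)) (hM.quad_tangent hTi)] at h2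
    linarith
  -- The position component removed by `projN` carries the factor `c`, so its pairing with `ξ`
  -- vanishes even for `c = 0`.
  have h3 : c * met c (f y) (ξ (f y)) = 0 := by
    by_cases hc : c = 0
    · simp [hc]
    · rw [← quad_eq_mul_met hc]
      exact hM.quad_normal (hfM y)
  rw [projN, met_sub_left, met_smul_left, h1, h2]
  linear_combination met c (pd i f y) (pd j f y) * h3

/-- The mean curvature vectors of a surface in `M` and in the space form differ by that of `M`. -/
theorem meanCurv_projN_eq (hM : IsUmbilicalHypersurface c (spaceForm n c) (projN c) 2 M ξ) {l : ℝ}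
    (hl : ∀ p ∈ M, ∀ v ∈ tangentTo M p, fderiv ℝ ξ p v = -(l • v)) (hfM : ∀ z, f z ∈ M)
    (hy : y ∈ range (𝓡∂ 2)) (hf : ContDiffWithinAt ℝ 2 f (range (𝓡∂ 2)) y)
    (hG : met c (pd 0 f y) (pd 0 f y) * met c (pd 1 f y) (pd 1 f y)
      - met c (pd 0 f y) (pd 1 f y) ^ 2 ≠ 0) :
    meanCurv c (projN c) f y = meanCurv c (projM c ξ) f y + l • ξ (f y) := by
  have hT : ∀ i, met c (ξ (f y)) (pd i f y) = 0 := fun i =>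
    hM.normal _ (hfM y) _ (pd_mem_tangentTo hfM hy (hf.differentiableWithinAt (by simp)) i)
  have hA : ∀ i j, secondFF c (projN c) f i j y =
      secondFF c (projM c ξ) f i j y + (l * met c (pd i f y) (pd j f y)) • ξ (f y) := by
    intro i j
    rw [secondFF, secondFF, normalPart, normalPart, projM, met_pd_pd_normal hM hl hfM hy hf,
      sub_eq_add_neg, ← neg_smul, perp_add, perp_smul, perp_of_orthogonal (hT 0) (hT 1)]
    module
  have h2 : (2 * (met c (pd 0 f y) (pd 0 f y) * met c (pd 1 f y) (pd 1 f y)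
      - met c (pd 0 f y) (pd 1 f y) ^ 2))⁻¹ * (2 * (met c (pd 0 f y) (pd 0 f y) *
        met c (pd 1 f y) (pd 1 f y) - met c (pd 0 f y) (pd 1 f y) ^ 2)) = 1 :=
    inv_mul_cancel₀ (mul_ne_zero two_ne_zero hG)
  rw [meanCurv, meanCurv, hA, hA, hA]
  set E := met c (pd 0 f y) (pd 0 f y)
  set G := met c (pd 1 f y) (pd 1 f y)
  set F := met c (pd 0 f y) (pd 1 f y)
  have h3 : l • ξ (f y) = ((2 * (E * G - F ^ 2))⁻¹ * (2 * (E * G - F ^ 2))) • l • ξ (f y) := by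
    rw [h2, one_smul]
  rw [h3]
  module

/-- A parallel mean curvature vector in the space form is parallel in `M` as well. -/
theorem normalPart_projM_eq_zero
    (hM : IsUmbilicalHypersurface c (spaceForm n c) (projN c) 2 M ξ) {l : ℝ}
    (hl : ∀ p ∈ M, ∀ v ∈ tangentTo M p, fderiv ℝ ξ p v = -(l • v)) (hfM : ∀ z, f z ∈ M)
    (hy : y ∈ range (𝓡∂ 2)) (hf : ContDiffWithinAt ℝ 2 f (range (𝓡∂ 2)) y)
    (hG : met c (pd 0 f y) (pd 0 f y) * met c (pd 1 f y) (pd 1 f y)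
      - met c (pd 0 f y) (pd 1 f y) ^ 2 ≠ 0) (i : Fin 2)
    (h : normalPart c (projN c) f y (pd i (meanCurv c (projN c) f) y) = 0) :
    normalPart c (projM c ξ) f y (pd i (meanCurv c (projM c ξ) f) y) = 0 := by
  have hu := (𝓡∂ 2).uniqueDiffOn y hy
  -- Without differentiability `pd` takes its default value `0` and the claim is trivial, so no
  -- regularity of the mean curvature has to be proved.
  by_cases hd : DifferentiableWithinAt ℝ (meanCurv c (projM c ξ) f) (range (𝓡∂ 2)) y
  swap
  · rw [pd, fderivWithin_zero_of_not_differentiableWithinAt hd, zero_apply]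
    simp [normalPart, perp, projM, projN, quad_zero_right, met_zero_left]
  have hfd : HasFDerivWithinAt f (fderivWithin ℝ f (range (𝓡∂ 2)) y) (range (𝓡∂ 2)) y :=
    (hf.differentiableWithinAt (by simp)).hasFDerivWithinAt
  have hT : ∀ i, pd i f y ∈ tangentTo M (f y) :=
    pd_mem_tangentTo hfM hy (hf.differentiableWithinAt (by simp))
  have hξ : ∀ i, met c (ξ (f y)) (pd i f y) = 0 := fun i => hM.normal _ (hfM y) _ (hT i)
  have hGe : ∀ᶠ z in 𝓝[range (𝓡∂ 2)] y, met c (pd 0 f z) (pd 0 f z) * met c (pd 1 f z) (pd 1 f z)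
      - met c (pd 0 f z) (pd 1 f z) ^ 2 ≠ 0 := by
    have h0 := (contDiffWithinAt_pd hy hf 0).continuousWithinAt
    have h1 := (contDiffWithinAt_pd hy hf 1).continuousWithinAt
    exact (((ContinuousWithinAt.met (c := c) h0 h0).mul (ContinuousWithinAt.met h1 h1)).sub
      ((ContinuousWithinAt.met h0 h1).pow 2)).eventually_ne hG
  have hH : meanCurv c (projN c) f =ᶠ[𝓝[range (𝓡∂ 2)] y]
      fun z => meanCurv c (projM c ξ) f z + l • ξ (f z) := by
    filter_upwards [hGe, eventually_contDiffWithinAt hy hf, self_mem_nhdsWithin] with z h1 h2 h3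
    exact meanCurv_projN_eq hM hl hfM h3 h2 h1
  have hHd := (hd.hasFDerivWithinAt.add
    (((hM.hasFDerivAt_normal (hfM y)).comp_hasFDerivWithinAt y hfd).const_smul l)).congr_of_eventuallyEq
      hH (hH.self_of_nhdsWithin hy)
  have hpd : pd i (meanCurv c (projM c ξ) f) y =
      pd i (meanCurv c (projN c) f) y + (l * l) • pd i f y := by
    have h1 : pd i (meanCurv c (projN c) f) y =
        pd i (meanCurv c (projM c ξ) f) y + l • fderiv ℝ ξ (f y) (pd i f y) := by
      rw [pd, hHd.fderivWithin hu]
      rfl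
    rw [h1, hl _ (hfM y) _ (hT i)]
    module
  have hpi : perp c (pd 0 f y) (pd 1 f y) (pd i f y) = 0 := by
    fin_cases i
    · exact perp_left hG
    · exact perp_right hG
  -- The unit normal of `M` is normal to the surface, so this component survives in the normal part,
  -- which is zero by `h`. Hence `projM` and `projN` agree on this vector.
  have hz : met c (projN c (f y) (pd i (meanCurv c (projN c) f) y)) (ξ (f y)) = 0 := by
    rw [← met_perp_of_orthogonal (a := pd 0 f y) (b := pd 1 f y) (by rw [met_comm, hξ])
      (by rw [met_comm, hξ])]
    change met c (normalPart c (projN c) f y _) _ = 0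
    rw [h, met_zero_left]
  rw [hpd, normalPart, projM_add, projM_smul, projM_of_tangent (hM.quad_tangent (hT i)) (hξ i),
    perp_add, perp_smul, hpi, projM, hz, zero_smul, sub_zero, smul_zero, add_zero]
  exact h

end ParametrizedSurface

/-! ### Branched surfaces in charts and their boundary -/

section BranchedSurface

open Filter Topology Set

variable {n : ℕ} {c : ℝ} {S : Type*} [TopologicalSpace S] [ChartedSpace (EuclideanHalfSpace 2) S]
  {u : S → Amb n}

theorem contDiffWithinAt_localRep (hu : ContMDiff (𝓡∂ 2) 𝓘(ℝ, Amb n) ∞ u) (p : S) :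
    ContDiffWithinAt ℝ ∞ (localRep u p) (range (𝓡∂ 2)) (extChartAt (𝓡∂ 2) p p) :=
  (contMDiffAt_iff.1 (hu p)).2

theorem localRep_self (u : S → Amb n) (p : S) :
    localRep u p (extChartAt (𝓡∂ 2) p p) = u p :=
  congrArg u (extChartAt_to_inv p)

theorem extChartAt_mem_range (p : S) : extChartAt (𝓡∂ 2) p p ∈ range (𝓡∂ 2) :=
  extChartAt_target_subset_range p (mem_extChartAt_target p)

theorem hasFDerivWithinAt_localRep (hu : ContMDiff (𝓡∂ 2) 𝓘(ℝ, Amb n) ∞ u) (p : S) :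
    HasFDerivWithinAt (localRep u p) (du u p) (range (𝓡∂ 2)) (extChartAt (𝓡∂ 2) p p) :=
  ((hu p).mdifferentiableAt (by simp)).hasMFDerivAt.2

theorem pd_localRep (hu : ContMDiff (𝓡∂ 2) 𝓘(ℝ, Amb n) ∞ u) (p : S) (i : Fin 2) :
    pd i (localRep u p) (extChartAt (𝓡∂ 2) p p) = du u p (EuclideanSpace.single i 1) := by
  rw [pd, (hasFDerivWithinAt_localRep hu p).fderivWithin
    ((𝓡∂ 2).uniqueDiffOn _ (extChartAt_mem_range p))]

theorem du_mem_tangentTo (hu : ContMDiff (𝓡∂ 2) 𝓘(ℝ, Amb n) ∞ u) {M : Set (Amb n)}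
    (huM : ∀ p, u p ∈ M) (p : S) (w : EuclideanSpace ℝ (Fin 2)) :
    du u p w ∈ tangentTo M (u p) := by
  have h := mem_tangentTo_of_hasFDerivWithinAt (hasFDerivWithinAt_localRep hu p)
    ((𝓡∂ 2).uniqueDiffOn _ (extChartAt_mem_range p)) (extChartAt_mem_range p)
    (X := M) (Eventually.of_forall fun z => huM _) w
  rwa [localRep_self] at h

/-- The Gram determinant of a surface does not vanish where it is immersed. -/
theorem gram_localRep_ne_zero (hu : ContMDiff (𝓡∂ 2) 𝓘(ℝ, Amb n) ∞ u)
    (hmem : ∀ p, u p ∈ spaceForm n c) {p : S} (hp : p ∉ branchSet u) :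
    met c (pd 0 (localRep u p) (extChartAt (𝓡∂ 2) p p))
        (pd 0 (localRep u p) (extChartAt (𝓡∂ 2) p p)) *
      met c (pd 1 (localRep u p) (extChartAt (𝓡∂ 2) p p))
        (pd 1 (localRep u p) (extChartAt (𝓡∂ 2) p p)) -
      met c (pd 0 (localRep u p) (extChartAt (𝓡∂ 2) p p))
        (pd 1 (localRep u p) (extChartAt (𝓡∂ 2) p p)) ^ 2 ≠ 0 := by
  rw [pd_localRep hu, pd_localRep hu]
  have hq : ∀ w, quad c (u p) (du u p w) = 0 := fun w =>
    quad_eq_zero_of_mem_tangentTo subset_rfl (du_mem_tangentTo hu hmem p w)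
  refine (gram_pos (hmem p) (hq _) (hq _) fun s t h => ?_).ne'
  have hinj : Function.Injective (du u p) := not_not.1 hp
  rw [← map_smul, ← map_smul, ← map_add] at h
  have h0 := hinj (h.trans (map_zero (du u p)).symm)
  have h1 := congrArg (fun z : EuclideanSpace ℝ (Fin 2) => z 0) h0
  have h2 := congrArg (fun z : EuclideanSpace ℝ (Fin 2) => z 1) h0
  simp at h1 h2
  exact ⟨h1, h2⟩

theorem hasParallelMeanCurv_projM {M : Set (Amb n)} {ξ : Amb n → Amb n}
    (hu : ContMDiff (𝓡∂ 2) 𝓘(ℝ, Amb n) ∞ u)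
    (hM : IsUmbilicalHypersurface c (spaceForm n c) (projN c) 2 M ξ) {l : ℝ}
    (hl : ∀ p ∈ M, ∀ v ∈ tangentTo M p, fderiv ℝ ξ p v = -(l • v)) (huM : ∀ p, u p ∈ M)
    (hpmc : HasParallelMeanCurv c (projN c) u) : HasParallelMeanCurv c (projM c ξ) u := by
  intro p hp i
  refine normalPart_projM_eq_zero hM hl (fun z => huM _) (extChartAt_mem_range p) ?_
    (gram_localRep_ne_zero hu (fun q => hM.subset (huM q)) hp) i (hpmc p hp i)
  exact_mod_cast contDiffWithinAt_infty.1 (contDiffWithinAt_localRep hu p) 2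

/-- An immersed surface has dimension at most that of the hypersurface containing it. -/
theorem three_le_of_notMem_branchSet {M : Set (Amb n)} {ξ : Amb n → Amb n}
    (hu : ContMDiff (𝓡∂ 2) 𝓘(ℝ, Amb n) ∞ u)
    (hM : IsUmbilicalHypersurface c (spaceForm n c) (projN c) 2 M ξ) (huM : ∀ p, u p ∈ M) {p : S}
    (hp : p ∉ branchSet u) : 3 ≤ n := by
  have hinj : Function.Injective (du u p) := not_not.1 hp
  have h := LinearMap.finrank_le_finrank_of_injective
    (f := (du u p : EuclideanSpace ℝ (Fin 2) →ₗ[ℝ] Amb n).codRestrict (tangentTo M (u p))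
      (du_mem_tangentTo hu huM p)) (fun a b hab => hinj (congrArg Subtype.val hab))
  rw [finrank_euclideanSpace_fin] at h
  have := hM.submanifold.finrank_tangentTo (huM p)
  omega

theorem extChartAt_boundary {p : S} (hp : p ∈ (𝓡∂ 2).boundary S) :
    extChartAt (𝓡∂ 2) p p 0 = 0 := by
  have h : extChartAt (𝓡∂ 2) p p ∈ frontier (range (𝓡∂ 2)) := hp
  rw [frontier_range_modelWithCornersEuclideanHalfSpace] at h
  exact h.symm

/-- Being a boundary point does not depend on the chart, so it can be tested in the chart at `p`. -/
theorem symm_mem_boundary [IsManifold (𝓡∂ 2) ∞ S] {p : S} {z : EuclideanSpace ℝ (Fin 2)}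
    (hz : z ∈ (extChartAt (𝓡∂ 2) p).target) (hz0 : z 0 = 0) :
    (extChartAt (𝓡∂ 2) p).symm z ∈ (𝓡∂ 2).boundary S := by
  have hsrc : (extChartAt (𝓡∂ 2) p).symm z ∈ (chartAt (EuclideanHalfSpace 2) p).source := by
    rw [← extChartAt_source (𝓡∂ 2)]
    exact (extChartAt (𝓡∂ 2) p).map_target hz
  refine ((𝓡∂ 2).isBoundaryPoint_iff_of_mem_atlas (n := ∞) (by simp)
    (chart_mem_atlas (EuclideanHalfSpace 2) p) hsrc).2 ?_
  change extChartAt (𝓡∂ 2) p ((extChartAt (𝓡∂ 2) p).symm z) ∈ frontier (extChartAt (𝓡∂ 2) p).target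
  rw [(extChartAt (𝓡∂ 2) p).right_inv hz]
  refine ⟨subset_closure hz, fun h => ?_⟩
  have h1 := interior_mono (extChartAt_target_subset_range p) h
  rw [interior_range_modelWithCornersEuclideanHalfSpace] at h1
  have h2 : 0 < z 0 := h1
  exact h2.ne' hz0

/-- Lines along the boundary of the half plane stay in the image of the chart for a short time. -/
theorem eventually_line_mem_target {p : S} (hp : p ∈ (𝓡∂ 2).boundary S)
    {t : EuclideanSpace ℝ (Fin 2)} (ht : t 0 = 0) :
    (∀ s : ℝ, (extChartAt (𝓡∂ 2) p p + s • t) 0 = 0) ∧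
      (∀ s : ℝ, extChartAt (𝓡∂ 2) p p + s • t ∈ range (𝓡∂ 2)) ∧
      ∀ᶠ s : ℝ in 𝓝 0, extChartAt (𝓡∂ 2) p p + s • t ∈ (extChartAt (𝓡∂ 2) p).target := by
  have h0 : ∀ s : ℝ, (extChartAt (𝓡∂ 2) p p + s • t) 0 = 0 := fun s => by
    rw [PiLp.add_apply, PiLp.smul_apply, ht, extChartAt_boundary hp, smul_zero, add_zero]
  have h1 : ∀ s : ℝ, extChartAt (𝓡∂ 2) p p + s • t ∈ range (𝓡∂ 2) := fun s => by
    rw [range_modelWithCornersEuclideanHalfSpace]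
    exact (h0 s).ge
  refine ⟨h0, h1, ?_⟩
  have hc : Tendsto (fun s : ℝ => extChartAt (𝓡∂ 2) p p + s • t) (𝓝 0)
      (𝓝[range (𝓡∂ 2)] (extChartAt (𝓡∂ 2) p p)) := by
    refine tendsto_nhdsWithin_iff.2 ⟨?_, Eventually.of_forall h1⟩
    have : Continuous (fun s : ℝ => extChartAt (𝓡∂ 2) p p + s • t) := by fun_prop
    simpa using this.tendsto 0
  exact hc.eventually (extChartAt_target_mem_nhdsWithin p)

theorem du_boundary_mem_tangentTo [IsManifold (𝓡∂ 2) ∞ S]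
    (hu : ContMDiff (𝓡∂ 2) 𝓘(ℝ, Amb n) ∞ u) {K : Set (Amb n)}
    (hK : ∀ p ∈ (𝓡∂ 2).boundary S, u p ∈ K) {p : S} (hp : p ∈ (𝓡∂ 2).boundary S)
    {t : EuclideanSpace ℝ (Fin 2)} (ht : t 0 = 0) : du u p t ∈ tangentTo K (u p) := by
  obtain ⟨h0, h1, h2⟩ := eventually_line_mem_target hp ht
  have hγ : HasFDerivAt (fun s : ℝ => extChartAt (𝓡∂ 2) p p + s • t)
      ((ContinuousLinearMap.id ℝ ℝ).smulRight t) 0 :=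
    ((hasFDerivAt_id (0 : ℝ)).smul_const t).const_add _
  have hf : HasFDerivWithinAt (localRep u p) (du u p) (range (𝓡∂ 2))
      (extChartAt (𝓡∂ 2) p p + (0 : ℝ) • t) := by
    rw [zero_smul, add_zero]
    exact hasFDerivWithinAt_localRep hu p
  have h3 := hf.comp (0 : ℝ) hγ.hasFDerivWithinAt (s := univ) (fun s _ => h1 s)
  rw [hasFDerivWithinAt_univ] at h3
  have h4 := mem_tangentTo_of_hasFDerivAt (X := K) h3
    (h2.mono fun s hs => hK _ (symm_mem_boundary hs (h0 s))) 1
  rw [Function.comp_apply, zero_smul, add_zero, localRep_self] at h4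
  simpa using h4

/-- The boundary contains points outside of any finite set. -/
theorem exists_boundary_notMem [IsManifold (𝓡∂ 2) ∞ S] (hS : ((𝓡∂ 2).boundary S).Nonempty)
    {B : Set S} (hB : B.Finite) : ∃ p ∈ (𝓡∂ 2).boundary S, p ∉ B := by
  obtain ⟨p, hp⟩ := hS
  have ht : (EuclideanSpace.single (1 : Fin 2) (1 : ℝ) : EuclideanSpace ℝ (Fin 2)) 0 = 0 := by simp
  obtain ⟨h0, -, h2⟩ := eventually_line_mem_target hp ht
  have hinf := infinite_of_mem_nhds (0 : ℝ) h2
  have hinj : InjOn (fun s : ℝ => (extChartAt (𝓡∂ 2) p).symm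
      (extChartAt (𝓡∂ 2) p p + s • EuclideanSpace.single (1 : Fin 2) (1 : ℝ)))
      {s : ℝ | extChartAt (𝓡∂ 2) p p + s • EuclideanSpace.single (1 : Fin 2) (1 : ℝ) ∈
        (extChartAt (𝓡∂ 2) p).target} := by
    intro s hs s' hs' h
    have h3 := add_left_cancel ((extChartAt (𝓡∂ 2) p).symm.injOn hs hs' h)
    simpa using congrArg (fun z : EuclideanSpace ℝ (Fin 2) => z 1) h3
  obtain ⟨q, ⟨s, hs, rfl⟩, hq⟩ := ((hinf.image hinj).sdiff hB).nonempty
  exact ⟨_, symm_mem_boundary hs (h0 s), hq⟩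

end BranchedSurface

/-! ### The contact angle with a geodesic sphere -/

section ContactAngle

variable {n : ℕ} {c : ℝ} {S : Type*} [TopologicalSpace S] [ChartedSpace (EuclideanHalfSpace 2) S]
  {u : S → Amb n} {o : Amb n} {r : ℝ}

/-- The contact angle with a geodesic sphere in terms of the outward normal and the conormal. -/
theorem IsContactAngle.exists_sin_eq [IsManifold (𝓡∂ 2) ∞ S]
    (hu : ContMDiff (𝓡∂ 2) 𝓘(ℝ, Amb n) ∞ u) (hmem : ∀ p, u p ∈ spaceForm n c)
    (hs : 0 < sn c r) (ho : o ∈ spaceForm n c)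
    (hfree : ∀ p ∈ (𝓡∂ 2).boundary S, u p ∈ geodSphere c o r) {p : S}
    (hp : p ∈ (𝓡∂ 2).boundary S) {θ : ℝ} (h : IsContactAngle c (geodSphere c o r) u p θ) :
    ∃ ν, IsOutConormal c u p ν ∧ Real.sin θ ^ 2 = met c (outNormal c o r (u p)) ν ^ 2 := by
  obtain ⟨-, ν, hν, hg⟩ := h
  refine ⟨ν, hν, ?_⟩
  obtain ⟨h1, h2⟩ := outNormal_unit hs ho (hmem p) (hfree p hp)
  have hνT : quad c (u p) ν = 0 := by
    obtain ⟨-, ⟨w, -, rfl⟩, -⟩ := hν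
    exact quad_eq_zero_of_mem_tangentTo subset_rfl (du_mem_tangentTo hu hmem p w)
  have hK := fun v => mem_tangentTo_geodSphere_iff (v := v) hs ho (hmem p) (hfree p hp)
  have hg' := isGreatest_contact (m := outNormal c o r (u p)) (ν := ν) (hmem p)
    (K := tangentTo (geodSphere c o r) (u p)) (T := tangentTo (spaceForm n c) (u p))
    (A := du u p) (fun v hv => (mem_tangentTo_spaceForm_iff (hmem p)).1 hv)
    (fun v => by rw [hK, mem_tangentTo_spaceForm_iff (hmem p)])
    ((mem_tangentTo_spaceForm_iff (hmem p)).2 h1) h2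
    ((mem_tangentTo_spaceForm_iff (hmem p)).2 hνT) hν.1
    (fun t ht => ((hK _).1 (du_boundary_mem_tangentTo hu hfree hp ht)).2) hν.2.2
  have hcos := hg.unique hg'
  have hle : met c (outNormal c o r (u p)) ν ^ 2 ≤ 1 := by
    rw [← hν.1]
    exact met_sq_le (hmem p) h1 hνT h2
  have := Real.sin_sq_add_cos_sq θ
  rw [hcos, Real.sq_sqrt (by linarith)] at this
  linarith

end ContactAngle

end SpaceFormPMC

/-! ### The main theorem -/

theorem mainTheorem3 {n : ℕ} (c : ℝ) {S : Type*} [TopologicalSpace S]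
    [ChartedSpace (EuclideanHalfSpace 2) S] [IsManifold (𝓡∂ 2) ∞ S]
    (g : Bundle.ContMDiffRiemannianMetric (𝓡∂ 2) ∞ (EuclideanSpace ℝ (Fin 2))
      (fun p : S => TangentSpace (𝓡∂ 2) p))
    (hS : ((𝓡∂ 2).boundary S).Nonempty)
    (o : Amb n) (ho : o ∈ spaceForm n c)
    (r : ℝ) (hr : 0 < r) (hrc : 0 < c → r < Real.pi / √c)
    (u : S → Amb n) (hu : IsBranchedImmersion c g u)
    (hball : ∀ p, u p ∈ geodBall c o r)
    (hfree : ∀ p ∈ (𝓡∂ 2).boundary S, u p ∈ geodSphere c o r)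
    (hpmc : HasParallelMeanCurv c (projN c) u)
    (hne : ∃ p ∉ branchSet u, meanCurvAt c (projN c) u p ≠ 0)
    (θ : ℝ) (hθ : 0 < θ)
    (hangle : ∀ p ∈ (𝓡∂ 2).boundary S, p ∉ branchSet u → IsContactAngle c (geodSphere c o r) u p θ)
    (M : Set (Amb n)) (ξ : Amb n → Amb n) (hMc : IsConnected M)
    (hM : IsUmbilicalHypersurface c (spaceForm n c) (projN c) 2 M ξ)
    (huM : ∀ p, u p ∈ M) :
    HasParallelMeanCurv c (projM c ξ) u ∧
    (∃ η, IsUmbilicalHypersurface c M (projM c ξ) 3 (M ∩ geodSphere c o r) η) ∧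
    ∃ α ∈ Set.Ioo 0 Real.pi, ∃ θM ∈ Set.Ioc 0 (Real.pi / 2),
      (∀ p ∈ (𝓡∂ 2).boundary S,
        |met c (outNormal c o r (u p)) (ξ (u p))| < 1 ∧
        met c (outNormal c o r (u p)) (ξ (u p)) = Real.cos α ∧
        Real.sin θM =
          Real.sin θ / √(1 - met c (outNormal c o r (u p)) (ξ (u p)) ^ 2)) ∧
      Real.sin θM = Real.sin θ / Real.sin α ∧
      ∀ p ∈ (𝓡∂ 2).boundary S, p ∉ branchSet u →
        IsContactAngle c (M ∩ geodSphere c o r) u p θM := by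
  obtain ⟨p₀, hp₀, -⟩ := hne
  have hs : 0 < sn c r := sn_pos hr hrc
  have hmem : ∀ p, u p ∈ spaceForm n c := hu.mem
  have hn : 3 ≤ n := three_le_of_notMem_branchSet hu.smooth hM huM hp₀
  obtain ⟨l, hl⟩ := hM.exists_const_curvature hMc.isPreconnected hn
  obtain ⟨κ, hκ⟩ := hM.exists_met_outNormal_eq (r := r) hMc.isPreconnected ho hl
  have hC : ∀ p ∈ (𝓡∂ 2).boundary S, u p ∈ M ∩ geodSphere c o r := fun p hp =>
    ⟨huM p, hfree p hp⟩
  have hνM : ∀ {p ν}, IsOutConormal c u p ν → ν ∈ tangentTo M (u p) := by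
    rintro p ν ⟨-, ⟨w, -, rfl⟩, -⟩
    exact du_mem_tangentTo hu.smooth huM p w
  -- One immersed boundary point suffices, since `κ` is constant; the bound then also serves at
  -- branch points. There `ν ⊥ ξ` gives `⟨n, ν⟩ = ⟨n - κ ξ, ν⟩`, and Cauchy-Schwarz applies.
  have hsin : 0 < Real.sin θ ∧ Real.sin θ ^ 2 ≤ 1 - κ ^ 2 := by
    obtain ⟨p, hp, hpB⟩ := exists_boundary_notMem hS hu.finite
    have ha := hangle p hp hpB
    obtain ⟨ν, hν, hν2⟩ := ha.exists_sin_eq hu.smooth hmem hs ho hfree hp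
    have hκp := hκ _ (hC p hp)
    obtain ⟨h1, h2, -⟩ := hM.outNormal_sub_mem hs ho (hC p hp) hκp
    have h3 := met_sq_le (hmem p) (hM.quad_tangent (hνM hν)) (hM.quad_tangent h1) hν.1
    rw [h2, met_sub_right, met_smul_right, met_comm ν (ξ (u p)),
      hM.normal _ (huM p) _ (hνM hν), mul_zero, sub_zero, met_comm ν, ← hν2] at h3
    exact ⟨Real.sin_pos_of_pos_of_lt_pi hθ (by linarith [ha.1.2, Real.pi_pos]), h3⟩
  obtain ⟨hsθ, hsκ⟩ := hsin
  have hκ1 : κ ^ 2 < 1 := by nlinarith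
  have hD : 0 < 1 - κ ^ 2 := by linarith
  have hDs : 0 < √(1 - κ ^ 2) := Real.sqrt_pos.2 hD
  have habs : |κ| < 1 := by rwa [← sq_lt_one_iff_abs_lt_one]
  obtain ⟨hκl, hκr⟩ := abs_lt.1 habs
  have hq0 : 0 < Real.sin θ / √(1 - κ ^ 2) := div_pos hsθ hDs
  have hq1 : Real.sin θ / √(1 - κ ^ 2) ≤ 1 := by
    rw [div_le_one hDs]
    exact Real.le_sqrt_of_sq_le hsκ
  have hsinM : Real.sin (Real.arcsin (Real.sin θ / √(1 - κ ^ 2))) = Real.sin θ / √(1 - κ ^ 2) :=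
    Real.sin_arcsin (by linarith) hq1
  have hη := hM.inter_geodSphere hs ho hl hκ1 hκ
  refine ⟨hasParallelMeanCurv_projM hu.smooth hM hl huM hpmc, ⟨_, hη⟩,
    Real.arccos κ, ⟨Real.arccos_pos.2 hκr, Real.arccos_lt_pi.2 hκl⟩,
    Real.arcsin (Real.sin θ / √(1 - κ ^ 2)), ⟨Real.arcsin_pos.2 hq0, Real.arcsin_le_pi_div_two _⟩,
    fun p hp => ?_, ?_, fun p hp hpB => ?_⟩
  · rw [hκ _ (hC p hp), Real.cos_arccos hκl.le hκr.le]
    exact ⟨habs, rfl, hsinM⟩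
  · rw [Real.sin_arccos, hsinM]
  · obtain ⟨ν, hν, hν2⟩ := (hangle p hp hpB).exists_sin_eq hu.smooth hmem hs ho hfree hp
    refine ⟨⟨(Real.arcsin_pos.2 hq0).le, Real.arcsin_le_pi_div_two _⟩, ν, hν, ?_⟩
    have hx := hC p hp
    have hT := (hM.exists_levelSet_inter hs ho hκ1 hx (hκ _ hx)).2
    -- On vectors tangent to `M`, the unit normal of the intersection pairs like `n / √(1 - κ²)`;
    -- this is the factor in the sine formula.
    have hmv : ∀ v ∈ tangentTo M (u p),
        met c ((√(1 - κ ^ 2))⁻¹ • (outNormal c o r (u p) - κ • ξ (u p))) v =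
          (√(1 - κ ^ 2))⁻¹ * met c (outNormal c o r (u p)) v := by
      intro v hv
      rw [met_smul_left, met_sub_left, met_smul_left, hM.normal _ (huM p) _ hv, mul_zero, sub_zero]
    have hg := isGreatest_contact (m := (√(1 - κ ^ 2))⁻¹ • (outNormal c o r (u p) - κ • ξ (u p)))
      (ν := ν) (hmem p) (K := tangentTo (M ∩ geodSphere c o r) (u p)) (T := tangentTo M (u p))
      (A := du u p) (fun v hv => hM.quad_tangent hv)
      (fun v => by
        rw [hT]
        refine and_congr_right fun hv => ?_
        rw [hmv v hv]
        simp [hDs.ne'])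
      (hη.tangent _ hx) (hη.unit _ hx) (hνM hν) hν.1
      (fun t ht => hη.normal _ hx _ (du_boundary_mem_tangentTo hu.smooth hC hp ht)) hν.2.2
    rw [hmv ν (hνM hν), mul_pow, ← hν2, ← mul_pow, mul_comm, ← div_eq_mul_inv] at hg
    rwa [Real.cos_arcsin]
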